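/- **Setting.** Let $\mathcal T$ be a perfect binary tree of depth $L$ whose leaves carry consecutive index vectors $I_\alpha$ that together form $[1,\dots,n]$; a non-leaf node carries the concatenation of the index vectors of its two children, and $|\tau|$ is the length of the index vector $I_\tau$ of $\tau$. For matrices $\{C_\tau\}$ attached to the nodes let $\mathbf C^{(\ell)}=\mathrm{blkdiag}(C_\tau:\operatorname{depth}\tau=\ell)$. A matrix $A\in\mathbb R^{n\times n}$ is an *HSS matrix of rank $\rho$* for $\mathcal T$ if there are matrices $U^{\rm big}_\tau,V^{\rm big}_\tau\in\mathbb R^{|\tau|\times \rho}$ (with orthonormal columns for all non-root $\tau$) such that $A_{\tau,\tau'}=U^{\rm big}_\tau\tilde A_{\tau,\tau'}(V^{\rm big}_{\tau'})^T$ with some $\tilde A_{\tau,\tau'}\in\mathbb R^{\rho\times\rho}$ for all siblings $\tau,\tau'$, and, for every non-leaf $\tau$ with children $\alpha,\beta$, $U^{\rm big}_\tau=\mathrm{blkdiag}(U^{\rm big}_\alpha,U^{\rm big}_\beta)U_\tau$ and $V^{\rm big}_\tau=\mathrm{blkdiag}(V^{\rm big}_\alpha,V^{\rm big}_\beta)V_\tau$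 with some $U_\tau,V_\tau\in\mathbb R^{2\rho\times \rho}$ with orthonormal columns. A *symmetric telescopic decomposition* $\{U_\tau,D_\tau\}_{\tau\in\mathcal T}$ of $A$ consists of symmetric $D_\tau$ (all $\tau$) and $U_\tau$ with orthonormal columns ($\tau$ not the root) such that, with $A^{(0)}:=D_{\rm root}$ and $A^{(\ell)}:=\mathbf D^{(\ell)}+\mathbf U^{(\ell)}A^{(\ell-1)}(\mathbf U^{(\ell)})^T$ for $1\le \ell\le L$, one has $A=A^{(L)}$. Here $U_\tau$ has $m_\tau$ columns (all $m_\tau$ are equal if the decomposition has a constant telescopic rank), and the number of rows of $U_\tau$ and $D_\tau$ is $|\tau|$ for a leaf and $m_\alpha+m_\beta$ for a node with children $\alpha,\beta$. It is *standard* if, for every $\ell\le L$ and every $\tau$ of depth $\ell$, $D_\tau$ is the diagonal block of $A^{(\ell)}$ at $\tau$. Let $\xi=(\xi_0,\dots,\xi_{k-1})$, $\xi_j\in\mathbb C\cup\{\infty\}$, be a list of poles closed (with multiplicities) under complex conjugation, and put $q_k(x)=\prod_{\xi_j\ne\infty}(x-\xi_j)$. For $M\in\mathbb R^{m\times m}$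 and $B\in\mathbb R^{m\times b}$, such that no $\xi_j$ is an eigenvalue of $M$, let $\mathcal Q(M,B,\xi)=\{q_k(M)^{-1}\sum_{j=0}^{k-1}M^jBK_j: K_j\in\mathbb R^{b\times b}\}$; an orthonormal basis of it is a matrix with orthonormal columns whose column space is spanned by the columns of the elements of $\mathcal Q(M,B,\xi)$. **Algorithm.** Given $\{U_\tau,D_\tau\}$, $f$ and $\xi$, process the nodes $\tau$ from the leaves to the root. For a leaf put $\tilde D_\tau=D_\tau$ and (if $\tau$ is not the root) $Z_\tau=U_\tau$. For a node $\tau$ with children $\alpha,\beta$ put $E_\tau=\mathrm{blkdiag}(W_\alpha^TZ_\alpha,W_\beta^TZ_\beta)$, $\tilde D_\tau=\mathrm{blkdiag}(W_\alpha^T\tilde D_\alpha W_\alpha,W_\beta^T\tilde D_\beta W_\beta)+E_\tau D_\tau E_\tau^T$ and (if $\tau$ is not the root) $Z_\tau=E_\tau U_\tau$. If $\tau$ is not the root, let $W_\tau$ be an orthonormal basis of $\mathcal Q(\tilde D_\tau,Z_\tau,\xi)$ (it is required that no pole is an eigenvalue of $\tilde D_\tau$) and put $C_\tau=f(\tilde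 D_\tau)-W_\tau f(W_\tau^T\tilde D_\tau W_\tau)W_\tau^T$; for the root put $C_\tau=f(\tilde D_\tau)$. The output is the matrix $F=F^{(L)}$ generated by $\{W_\tau,C_\tau\}$, that is, $F^{(0)}=C_{\rm root}$ and $F^{(\ell)}=\mathbf C^{(\ell)}+\mathbf W^{(\ell)}F^{(\ell-1)}(\mathbf W^{(\ell)})^T$ for $1\le\ell\le L$. **Theorem.** Let $A\in\mathbb R^{n\times n}$ be a symmetric HSS matrix for a cluster tree $\mathcal T$ of depth $L$, and let $\{U_\tau,D_\tau\}$ be a standard symmetric telescopic decomposition of $A$. Let $f$ be a real function that is analytic on an interval $[\lambda_{\min},\lambda_{\max}]$ containing the eigenvalues of $A$. Then every output $F$ of the algorithm applied to $\{U_\tau,D_\tau\}$, $f$ and $\xi$ satisfies $$\|f(A)-F\|_2\le 4L\min_{r\in\mathbb P_k/q_k}\|f-r\|_\infty ,$$ where $\mathbb P_k$ is the set of (complex) polynomials of degree at most $k-1$, $\|\cdot\|_\infty$ is the supremum norm on $[\lambda_{\min},\lambda_{\max}]$, and the minimum is attained. In particular $F=f(A)$ if $f$ coincides on $[\lambda_{\min},\lambda_{\max}]$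 with an element of $\mathbb P_k/q_k$. -/

import Mathlib

open Polynomial

noncomputable section

namespace HSSFun

/-! ### Cluster trees

The nodes of depth `ℓ` of a perfect binary tree are numbered from left to right by `Fin (2 ^ ℓ)`. -/

/-- The children (`b = 0` left, `b = 1` right) of a node; `child τ b` has number `2 τ + b`. -/
def child {ℓ : ℕ} (τ : Fin (2 ^ ℓ)) (b : Fin 2) : Fin (2 ^ (ℓ + 1)) :=
  finProdFinEquiv (τ, b)

/-- A cluster tree of depth `L` for the indices `0, …, n - 1`, given by the lengths of the
consecutive index vectors that belong to its leaves. -/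
structure ClusterTree (n L : ℕ) where
  leafSize : Fin (2 ^ L) → ℕ
  sum_leafSize : ∑ τ, leafSize τ = n

/-- Pairs (block number, position inside the block) for blocks of sizes `s τ`. -/
abbrev BlockIdx {N : ℕ} (s : Fin N → ℕ) : Type := Σ τ : Fin N, Fin (s τ)

/-- Position `i` in leaf `τ` is the index `(∑ σ < τ, |σ|) + i`. -/
def ClusterTree.enum {n L : ℕ} (T : ClusterTree n L) : BlockIdx T.leafSize ≃ Fin n :=
  finSigmaFinEquiv.trans (finCongr T.sum_leafSize)

/-- The index set `I_τ` of a node `τ` of depth `ℓ ≤ L`: all indices that belong to leaves below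
`τ`. The leaf number `σ` lies below `τ` iff `⌊σ / 2 ^ (L - ℓ)⌋ = τ`. -/
def ClusterTree.cluster {n L : ℕ} (T : ClusterTree n L) (ℓ : ℕ) (τ : Fin (2 ^ ℓ)) :
    Finset (Fin n) :=
  Finset.univ.filter fun i => ((T.enum.symm i).1 : ℕ) / 2 ^ (L - ℓ) = (τ : ℕ)

/-- A matrix has orthonormal columns. -/
def OrthonormalCols {m p : Type*} [Fintype m] [DecidableEq p] (U : Matrix m p ℝ) : Prop :=
  U.transpose * U = 1

/-! ### HSS matrices -/

/-- The submatrix of `A` with rows in `I` and columns in `J`. -/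
def subBlock {n : ℕ} (A : Matrix (Fin n) (Fin n) ℝ) (I J : Finset (Fin n)) : Matrix I J ℝ :=
  A.submatrix (fun i => (i : Fin n)) (fun j => (j : Fin n))

/-- The block diagonal matrix `[X 0; 0 Y]` where the rows of `X` and `Y` are indexed by the two
parts `I₁`, `I₂` of the index set `I`. -/
def stackDiag {n r : ℕ} (I I₁ I₂ : Finset (Fin n)) (X : Matrix I₁ (Fin r) ℝ)
    (Y : Matrix I₂ (Fin r) ℝ) : Matrix I (Fin r ⊕ Fin r) ℝ :=
  Matrix.of fun i j => match j with
    | .inl j => if h : (i : Fin n) ∈ I₁ then X ⟨i, h⟩ j else 0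
    | .inr j => if h : (i : Fin n) ∈ I₂ then Y ⟨i, h⟩ j else 0

/-- `A` is an HSS matrix of HSS rank `r` for the cluster tree `T`; `Ub`, `Vb` are the families
`U^(big)`, `V^(big)`, of which only the nodes of depth at most `L` matter. -/
def ClusterTree.IsHSS {n L : ℕ} (T : ClusterTree n L) (r : ℕ) (A : Matrix (Fin n) (Fin n) ℝ) :
    Prop :=
  ∃ Ub Vb : ∀ (ℓ : ℕ) (τ : Fin (2 ^ ℓ)), Matrix (T.cluster ℓ τ) (Fin r) ℝ,
    (∀ ℓ, 1 ≤ ℓ → ℓ ≤ L → ∀ τ, OrthonormalCols (Ub ℓ τ) ∧ OrthonormalCols (Vb ℓ τ)) ∧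
    (∀ ℓ, ℓ < L → ∀ (τ : Fin (2 ^ ℓ)) (b c : Fin 2), b ≠ c →
      ∃ At : Matrix (Fin r) (Fin r) ℝ,
        subBlock A (T.cluster (ℓ + 1) (child τ b)) (T.cluster (ℓ + 1) (child τ c)) =
          Ub (ℓ + 1) (child τ b) * At * (Vb (ℓ + 1) (child τ c)).transpose) ∧
    (∀ ℓ, ℓ < L → ∀ τ : Fin (2 ^ ℓ), ∃ U V : Matrix (Fin r ⊕ Fin r) (Fin r) ℝ,
      OrthonormalCols U ∧ OrthonormalCols V ∧
      Ub ℓ τ = stackDiag (T.cluster ℓ τ) (T.cluster (ℓ + 1) (child τ 0))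
        (T.cluster (ℓ + 1) (child τ 1))
        (Ub (ℓ + 1) (child τ 0)) (Ub (ℓ + 1) (child τ 1)) * U ∧
      Vb ℓ τ = stackDiag (T.cluster ℓ τ) (T.cluster (ℓ + 1) (child τ 0))
        (T.cluster (ℓ + 1) (child τ 1))
        (Vb (ℓ + 1) (child τ 0)) (Vb (ℓ + 1) (child τ 1)) * V)

/-! ### Symmetric telescopic decompositions -/

/-- Block sizes after merging the blocks of any two siblings. -/
def parentSize {ℓ : ℕ} (m : Fin (2 ^ (ℓ + 1)) → ℕ) : Fin (2 ^ ℓ) → ℕ :=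
  fun τ => m (child τ 0) + m (child τ 1)

/-- The identification of the indices of the merged blocks with those of the original blocks:
block `τ` is the concatenation of the blocks of the two children of `τ`. -/
def split {ℓ : ℕ} (m : Fin (2 ^ (ℓ + 1)) → ℕ) (x : BlockIdx (parentSize m)) : BlockIdx m :=
  Fin.addCases (motive := fun _ => BlockIdx m) (fun i => ⟨child x.1 0, i⟩)
    (fun i => ⟨child x.1 1, i⟩) x.2

/-- The generators of a symmetric telescopic decomposition on a tree of depth `L` whose leaves have
sizes `s`. On a tree of depth `0` there is only the matrix `D` of the root. On a tree of depth
`L + 1` there are the matrices `D τ` (of size `s τ × s τ`) and `U τ` (of size `s τ × m τ`) of the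
leaves, and the generators on the tree of depth `L` whose leaves have the sizes
`m α + m β`, with `α`, `β` the children. For telescopic rank `r` all `m τ` are `r`, and the trees
that occur above the leaves are the balanced trees with leaves of size `2 r`. -/
inductive TelDecomp : (L : ℕ) → (Fin (2 ^ L) → ℕ) → Type
  | root (s : Fin (2 ^ 0) → ℕ) (D : ∀ τ, Matrix (Fin (s τ)) (Fin (s τ)) ℝ) : TelDecomp 0 s
  | level {L : ℕ} (s m : Fin (2 ^ (L + 1)) → ℕ)
      (D : ∀ τ, Matrix (Fin (s τ)) (Fin (s τ)) ℝ)
      (U : ∀ τ, Matrix (Fin (s τ)) (Fin (m τ)) ℝ)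
      (up : TelDecomp L (parentSize m)) : TelDecomp (L + 1) s

/-- The block diagonal matrix of the `U τ`, its columns regarded as indexed by the merged blocks. -/
def blkdiagU {L : ℕ} {s m : Fin (2 ^ (L + 1)) → ℕ} (U : ∀ τ, Matrix (Fin (s τ)) (Fin (m τ)) ℝ) :
    Matrix (BlockIdx s) (BlockIdx (parentSize m)) ℝ :=
  (Matrix.blockDiagonal' U).submatrix id (split m)

/-- The matrix generated by a symmetric telescopic decomposition. -/
def TelDecomp.toMatrix {L : ℕ} {s : Fin (2 ^ L) → ℕ} :
    TelDecomp L s → Matrix (BlockIdx s) (BlockIdx s) ℝ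
  | .root _ D => Matrix.blockDiagonal' D
  | .level _ _ D U up =>
      Matrix.blockDiagonal' D + blkdiagU U * up.toMatrix * (blkdiagU U).transpose

/-- All `U τ` have orthonormal columns and all `D τ` are symmetric. -/
def TelDecomp.IsSymmetric {L : ℕ} {s : Fin (2 ^ L) → ℕ} : TelDecomp L s → Prop
  | .root _ D => ∀ τ, (D τ).IsSymm
  | .level _ _ D U up =>
      (∀ τ, (D τ).IsSymm) ∧ (∀ τ, OrthonormalCols (U τ)) ∧ up.IsSymmetric

/-- A decomposition is standard if on every level `D τ` is the diagonal block at `τ` of the matrix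
that is generated by the part of the decomposition up to that level (on level `0` this always
holds). -/
def TelDecomp.IsStandard {L : ℕ} {s : Fin (2 ^ L) → ℕ} : TelDecomp L s → Prop
  | .root _ _ => True
  | .level s m D U up =>
      (∀ τ, (TelDecomp.level s m D U up).toMatrix.blockDiag' τ = D τ) ∧ up.IsStandard

/-- The `n × n` matrix generated by a decomposition on the cluster tree `T`. -/
def ClusterTree.matrixOf {n L : ℕ} (T : ClusterTree n L) (t : TelDecomp L T.leafSize) :
    Matrix (Fin n) (Fin n) ℝ :=
  Matrix.reindex T.enum T.enum t.toMatrix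

/-! ### Rational Krylov subspaces -/

/-- The polynomial `∏ (x - ξ)` over the finite poles `ξ` of the list. -/
def poleDenom {k : ℕ} (ξ : Fin k → OnePoint ℂ) : ℂ[X] :=
  ∏ j, (ξ j).elim 1 (fun z => X - C z)

/-- The list of poles is closed under complex conjugation, with multiplicities (`∞` is its own
conjugate). -/
def ConjClosed {k : ℕ} (ξ : Fin k → OnePoint ℂ) : Prop :=
  ∃ σ : Equiv.Perm (Fin k), ∀ j, ξ (σ j) = (ξ j).map (starRingEnd ℂ)

/-- A real matrix regarded as a complex one. -/
def toC {m p : Type*} (M : Matrix m p ℝ) : Matrix m p ℂ :=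
  M.map (fun x => (x : ℂ))

/-- No pole is an eigenvalue of `M`. -/
def PolesAdmissible {n k : ℕ} (M : Matrix (Fin n) (Fin n) ℝ) (ξ : Fin k → OnePoint ℂ) : Prop :=
  ∀ z ∈ spectrum ℂ (toC M), ∀ j, ξ j ≠ (z : OnePoint ℂ)

/-- The block rational Krylov subspace `Q(M, B, ξ)`. -/
def ratKrylov {n b k : ℕ} (M : Matrix (Fin n) (Fin n) ℝ) (B : Matrix (Fin n) (Fin b) ℝ)
    (ξ : Fin k → OnePoint ℂ) : Set (Matrix (Fin n) (Fin b) ℝ) :=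
  {Y | ∃ K : Fin k → Matrix (Fin b) (Fin b) ℝ,
    toC Y = (aeval (toC M) (poleDenom ξ))⁻¹ * toC (∑ j : Fin k, M ^ (j : ℕ) * B * K j)}

/-- The columns of `W` are orthonormal and span the same space as the columns of the block vectors
in `Q`. -/
def IsOrthonormalBasisOf {n b p : ℕ} (W : Matrix (Fin n) (Fin p) ℝ)
    (Q : Set (Matrix (Fin n) (Fin b) ℝ)) : Prop :=
  OrthonormalCols W ∧
    Submodule.span ℝ (Set.range W.col) = Submodule.span ℝ {v | ∃ Y ∈ Q, ∃ j, v = Y.col j}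

/-! ### The algorithm -/

/-- The block diagonal matrix `[X 0; 0 Y]`. -/
def diag2 {a b c d : ℕ} (X : Matrix (Fin a) (Fin b) ℝ) (Y : Matrix (Fin c) (Fin d) ℝ) :
    Matrix (Fin (a + c)) (Fin (b + d)) ℝ :=
  Matrix.reindex finSumFinEquiv finSumFinEquiv (Matrix.fromBlocks X 0 0 Y)

/-- Replace `D τ` by `F τ + E τ * D τ * (E τ)ᵀ` and `U τ` by `E τ * U τ` at the leaves. -/
def TelDecomp.updateLeaves {L : ℕ} {s s' : Fin (2 ^ L) → ℕ} :
    TelDecomp L s → (∀ τ, Matrix (Fin (s' τ)) (Fin (s τ)) ℝ) →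
      (∀ τ, Matrix (Fin (s' τ)) (Fin (s' τ)) ℝ) → TelDecomp L s'
  | .root _ D, E, F => .root s' fun τ => F τ + E τ * D τ * (E τ).transpose
  | .level _ m D U up, E, F =>
      .level s' m (fun τ => F τ + E τ * D τ * (E τ).transpose) (fun τ => E τ * U τ) up

/-- `AlgorithmRun f ξ t out`: starting from the generators `{U τ, D τ} = t`, the algorithm with the
function `f` and the poles `ξ` can return the generators `{W τ, C τ} = out`. (It is a relation
because the algorithm is free to choose the orthonormal bases `W τ`.) The levels are processed from
the leaves to the root. In `level`, the matrices `Dt τ` and `Z τ` are the current matrices `D̃ τ` and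
`Z τ` at the nodes of the current level, and `up` holds the input generators of the levels above;
at the start `Z τ = U τ` and `D̃ τ = D τ` for the leaves. -/
inductive AlgorithmRun (f : ℝ → ℝ) {k : ℕ} (ξ : Fin k → OnePoint ℂ) :
    {L : ℕ} → {s : Fin (2 ^ L) → ℕ} → TelDecomp L s → TelDecomp L s → Prop
  | root (s : Fin (2 ^ 0) → ℕ) (Dt : ∀ τ, Matrix (Fin (s τ)) (Fin (s τ)) ℝ) :
      AlgorithmRun f ξ (.root s Dt) (.root s fun τ => cfc f (Dt τ))
  | level {L : ℕ} (s m p : Fin (2 ^ (L + 1)) → ℕ)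
      (Dt : ∀ τ, Matrix (Fin (s τ)) (Fin (s τ)) ℝ)
      (Z : ∀ τ, Matrix (Fin (s τ)) (Fin (m τ)) ℝ)
      (up : TelDecomp L (parentSize m))
      (W : ∀ τ, Matrix (Fin (s τ)) (Fin (p τ)) ℝ)
      (out : TelDecomp L (parentSize p))
      (poles : ∀ τ, PolesAdmissible (Dt τ) ξ)
      (basis : ∀ τ, IsOrthonormalBasisOf (W τ) (ratKrylov (Dt τ) (Z τ) ξ))
      (next : AlgorithmRun f ξ
        (up.updateLeaves (s' := parentSize p)
          (fun τ => diag2 ((W (child τ 0)).transpose * Z (child τ 0))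
            ((W (child τ 1)).transpose * Z (child τ 1)))
          (fun τ => diag2 ((W (child τ 0)).transpose * Dt (child τ 0) * W (child τ 0))
            ((W (child τ 1)).transpose * Dt (child τ 1) * W (child τ 1))))
        out) :
      AlgorithmRun f ξ (.level s m Dt Z up)
        (.level s p
          (fun τ => cfc f (Dt τ) -
            W τ * cfc f ((W τ).transpose * Dt τ * W τ) * (W τ).transpose)
          W out)

/-! ### Norms and rational approximation -/

/-- The spectral norm of a matrix. -/
def norm2 {n : ℕ} (M : Matrix (Fin n) (Fin n) ℝ) : ENNReal :=
  ‖Matrix.toEuclideanCLM (n := Fin n) (𝕜 := ℝ) M‖ₑ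

/-- The set `P_k / q_k` of rational functions `p / q_k` with `p` of degree at most `k - 1`. -/
def ratSpace {k : ℕ} (ξ : Fin k → OnePoint ℂ) : Set (RatFunc ℂ) :=
  {r | ∃ p : ℂ[X], p.degree < (k : WithBot ℕ) ∧
    r = algebraMap ℂ[X] (RatFunc ℂ) p / algebraMap ℂ[X] (RatFunc ℂ) (poleDenom ξ)}

/-- The value of a rational function at a real point (common factors of numerator and denominator
are cancelled first). -/
def evalAt (r : RatFunc ℂ) (x : ℝ) : ℂ :=
  r.eval (RingHom.id ℂ) (x : ℂ)

/-- The supremum norm of `f - r` on `[a, b]`; it is `∞` if `r` has a pole there and `a < b`. -/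
def supDist (f : ℝ → ℝ) (r : RatFunc ℂ) (a b : ℝ) : ENNReal :=
  ⨆ x ∈ Set.Icc a b, ‖(f x : ℂ) - evalAt r x‖ₑ

end HSSFun

end

noncomputable section

namespace HSSFun

open Matrix

/-! The matrices of the algorithm telescope: one level replaces `A` by its compression `Wᵀ A W` to
the columns of the block diagonal matrix `W` of that level, and the recursion continues with this
matrix. Hence it suffices to bound the error of a single level, which replaces `f(A)` by
`f(D) - W f(Wᵀ D W) Wᵀ + W f(Wᵀ A W) Wᵀ`, where `D` is the block diagonal of `A` and
`A = D + U B Uᵀ`.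

If `f = s / q` and the columns of `W` span the rational Krylov space of `D` and `U` with
denominator `q`, this replacement is exact. Indeed
`f(A) - f(D) = q(D)⁻¹ (q(D) s(A) - s(D) q(A)) q(A)⁻¹`, and the Bezoutian in the middle is a
combination of terms `D ^ i (D - A) A ^ j` with `i, j < k`. As `D - A = -U B Uᵀ`, only the vectors
`q(D)⁻¹ D ^ i U` and `q(A)⁻¹ A ^ j U` enter, and both are reproduced exactly from the compressed
matrices. For general `f` each of the four occurrences of `f` costs `‖f - s / q‖`, because
diagonal blocks and compressions of `A` have their spectra in `[a, b]`; this gives the constant `4`.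

The polynomial `q_k` may vanish in `[a, b]`. A rational function with a pole there is at infinite
distance from `f`, so that `q_k` is replaced by its factor `q` without zeros in `[a, b]`. This makes
the admissible functions a finite-dimensional space, in which best approximations exist. -/

section Bezoutian

variable {R A B : Type*} [CommRing R] [Ring A] [Algebra R A] [Ring B] [Algebra R B]

theorem pow_sub_pow_eq_sum (x y : A) (d : ℕ) :
    x ^ d - y ^ d = ∑ i ∈ Finset.range d, x ^ i * (x - y) * y ^ (d - 1 - i) := by
  induction d with
  | zero => simp
  | succ d ih =>
    have hshift : ∀ i ∈ Finset.range d,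
        x ^ i * (x - y) * y ^ (d + 1 - 1 - i) = x ^ i * (x - y) * y ^ (d - 1 - i) * y := by
      intro i hi
      rw [Finset.mem_range] at hi
      rw [mul_assoc _ _ y, ← pow_succ, show d - 1 - i + 1 = d + 1 - 1 - i by omega]
    rw [Finset.sum_range_succ, Finset.sum_congr rfl hshift, ← Finset.sum_mul, ← ih,
      pow_succ x, pow_succ y]
    simp only [Nat.add_sub_cancel, Nat.sub_self, pow_zero]
    noncomm_ring

theorem pow_mul_pow_sub_pow_mul_pow_eq_sum (x y : A) (i d : ℕ) :
    x ^ (d + i) * y ^ i - x ^ i * y ^ (d + i) =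
      ∑ l ∈ Finset.range d, x ^ (i + l) * (x - y) * y ^ (d - 1 - l + i) := by
  have hfactor : x ^ (d + i) * y ^ i - x ^ i * y ^ (d + i) = x ^ i * (x ^ d - y ^ d) * y ^ i := by
    rw [add_comm d i, pow_add x, add_comm i d, pow_add y, mul_sub, sub_mul,
      mul_assoc (x ^ i) (y ^ d)]
  rw [hfactor, pow_sub_pow_eq_sum, Finset.mul_sum, Finset.sum_mul]
  simp only [pow_add, mul_assoc]

/-- The Bezoutian `q(x) p(y) - p(x) q(y)` of two polynomials at two elements `x`, `y` that need not
commute. It is the numerator of the difference of `p / q` at `y` and at `x`. -/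
def bezoutian (p q : R[X]) (x y : A) : A :=
  aeval x q * aeval y p - aeval x p * aeval y q

theorem bezoutian_eq_sum {p q : R[X]} {κ : ℕ} (hp : p.natDegree ≤ κ) (hq : q.natDegree ≤ κ)
    (x y : A) :
    bezoutian p q x y = ∑ i ∈ Finset.range (κ + 1), ∑ j ∈ Finset.range (κ + 1),
      (q.coeff i * p.coeff j) • (x ^ i * y ^ j - x ^ j * y ^ i) := by
  have haeval : ∀ (z : A) {s : R[X]}, s.natDegree ≤ κ →
      aeval z s = ∑ i ∈ Finset.range (κ + 1), s.coeff i • z ^ i := fun z s hs =>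
    aeval_eq_sum_range' (Nat.lt_succ_of_le hs) z
  simp only [bezoutian, haeval _ hp, haeval _ hq, Finset.sum_mul_sum, smul_mul_smul_comm,
    smul_sub, Finset.sum_sub_distrib]
  rw [Finset.sum_comm (f := fun i j => (p.coeff i * q.coeff j) • (x ^ i * y ^ j))]
  simp only [mul_comm (p.coeff _)]

-- The coefficients of the products `x ^ i * (x - y) * y ^ j` in a Bezoutian depend only on
-- `p` and `q`.
theorem map_bezoutian_eq {E : Type*} [AddCommGroup E] [Module R E]
    {φ : A →ₗ[R] E} {ψ : B →ₗ[R] E} {x y : A} {x' y' : B} {κ : ℕ}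
    (h : ∀ i < κ, ∀ j < κ, φ (x ^ i * (x - y) * y ^ j) = ψ (x' ^ i * (x' - y') * y' ^ j))
    {p q : R[X]} (hp : p.natDegree ≤ κ) (hq : q.natDegree ≤ κ) :
    φ (bezoutian p q x y) = ψ (bezoutian p q x' y') := by
  have hle : ∀ i j, i ≤ j → j ≤ κ →
      φ (x ^ j * y ^ i - x ^ i * y ^ j) = ψ (x' ^ j * y' ^ i - x' ^ i * y' ^ j) := by
    intro i j hij hj
    obtain ⟨d, rfl⟩ := Nat.exists_eq_add_of_le hij
    rw [add_comm i d] at hj ⊢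
    simp only [pow_mul_pow_sub_pow_mul_pow_eq_sum, map_sum]
    refine Finset.sum_congr rfl fun l hl => ?_
    rw [Finset.mem_range] at hl
    exact h _ (by omega) _ (by omega)
  have hmonomial : ∀ i ≤ κ, ∀ j ≤ κ,
      φ (x ^ i * y ^ j - x ^ j * y ^ i) = ψ (x' ^ i * y' ^ j - x' ^ j * y' ^ i) := by
    intro i hi j hj
    rcases le_total i j with hij | hji
    · rw [← neg_sub, ← neg_sub (x' ^ j * _), map_neg, map_neg, hle i j hij hj]
    · exact hle j i hji hi
  rw [bezoutian_eq_sum hp hq, bezoutian_eq_sum hp hq]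
  simp only [map_sum, map_smul]
  refine Finset.sum_congr rfl fun i hi => Finset.sum_congr rfl fun j hj => ?_
  rw [hmonomial i (Finset.mem_range_succ_iff.mp hi) j (Finset.mem_range_succ_iff.mp hj)]

end Bezoutian

section RationalKrylov

variable {R n p u : Type*} [CommRing R] [Fintype n] [DecidableEq n]

theorem commute_nonsing_inv_aeval (M : Matrix n n R) (s q : R[X]) :
    Commute (aeval M q)⁻¹ (aeval M s) := by
  have hcomm : Commute (aeval M q) (aeval M s) := (Commute.all q s).map (aeval M)
  rw [nonsing_inv_eq_ringInverse]
  by_cases hu : IsUnit (aeval M q)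
  · obtain ⟨v, hv⟩ := hu
    rw [← hv] at hcomm ⊢
    rw [Ring.inverse_unit]
    exact hcomm.units_inv_left
  · rw [Ring.inverse_non_unit _ hu]
    exact Commute.zero_left _

theorem transpose_aeval (M : Matrix n n R) (q : R[X]) : (aeval M q)ᵀ = aeval Mᵀ q := by
  induction q using Polynomial.induction_on' with
  | add p q hp hq => simp [hp, hq]
  | monomial i c => simp [aeval_monomial, Algebra.algebraMap_eq_smul_one, Matrix.transpose_pow]

/-- The value `q(M)⁻¹ s(M)` of the rational function `s / q` at the matrix `M`; it is a junk value
if `q(M)` is not invertible. -/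
def ratAeval (s q : R[X]) (M : Matrix n n R) : Matrix n n R :=
  (aeval M q)⁻¹ * aeval M s

theorem transpose_ratAeval (s q : R[X]) (M : Matrix n n R) :
    (ratAeval s q M)ᵀ = ratAeval s q Mᵀ := by
  rw [ratAeval, ratAeval, transpose_mul, transpose_nonsing_inv, transpose_aeval, transpose_aeval,
    (commute_nonsing_inv_aeval Mᵀ s q).eq]

theorem aeval_mul_ratAeval (t s q : R[X]) (M : Matrix n n R) :
    aeval M t * ratAeval s q M = ratAeval (t * s) q M := by
  rw [ratAeval, ratAeval, ← mul_assoc, ← (commute_nonsing_inv_aeval M t q).eq, mul_assoc, map_mul]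

theorem ratAeval_self {q : R[X]} {M : Matrix n n R} (hq : IsUnit (aeval M q)) :
    ratAeval q q M = 1 :=
  Matrix.nonsing_inv_mul _ ((Matrix.isUnit_iff_isUnit_det _).mp hq)

theorem ratAeval_mul_aeval {s q : R[X]} {M : Matrix n n R} (hq : IsUnit (aeval M q)) :
    ratAeval s q M * aeval M q = aeval M s := by
  have hinv : (aeval M q)⁻¹ * aeval M q = 1 := ratAeval_self hq
  rw [ratAeval, (commute_nonsing_inv_aeval M s q).eq, mul_assoc, hinv, mul_one]

theorem ratAeval_X_pow (i : ℕ) (q : R[X]) (M : Matrix n n R) :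
    ratAeval (X ^ i) q M = (aeval M q)⁻¹ * M ^ i := by
  rw [ratAeval, map_pow, aeval_X]

theorem ratAeval_sub_ratAeval {D A : Matrix n n R} {s q : R[X]} (hD : IsUnit (aeval D q))
    (hA : IsUnit (aeval A q)) :
    ratAeval s q A - ratAeval s q D = (aeval D q)⁻¹ * bezoutian s q D A * (aeval A q)⁻¹ := by
  have hqD : (aeval D q)⁻¹ * aeval D q = 1 := ratAeval_self hD
  have hqA : aeval A q * (aeval A q)⁻¹ = 1 := by
    rw [← (commute_nonsing_inv_aeval A q q).eq]
    exact ratAeval_self hA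
  rw [bezoutian, mul_sub, sub_mul, ← mul_assoc, hqD, one_mul, mul_assoc, mul_assoc, hqA, mul_one,
    ratAeval, ratAeval, (commute_nonsing_inv_aeval A s q).eq]

theorem ratAeval_mul_mul {g q : R[X]} {M : Matrix n n R} (hgq : IsUnit (aeval M (g * q)))
    (s : R[X]) : ratAeval (g * s) (g * q) M = ratAeval s q M := by
  have hinv : (aeval M q)⁻¹ = (aeval M (g * q))⁻¹ * aeval M g := by
    refine Matrix.inv_eq_left_inv ?_
    rw [mul_assoc, ← map_mul]
    exact ratAeval_self hgq
  rw [ratAeval, ratAeval, hinv, map_mul (aeval M) g s, mul_assoc]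

theorem degree_X_pow_lt {κ i : ℕ} (hi : i < κ) : (X ^ i : R[X]).degree < κ :=
  (degree_X_pow_le i).trans_lt (by exact_mod_cast hi)

/-- The matrix `P` (in the applications an orthogonal projection) fixes the columns of all
`q(M)⁻¹ s(M) U` with `deg s < κ`, which form a block rational Krylov space of `M` and `U`. -/
def FixesKrylov (P : Matrix n n R) (q : R[X]) (κ : ℕ) (M : Matrix n n R) (U : Matrix n u R) :
    Prop :=
  ∀ s : R[X], s.degree < κ → P * (ratAeval s q M * U) = ratAeval s q M * U

theorem FixesKrylov.of_mul {P M : Matrix n n R} {U : Matrix n u R} {g q : R[X]} {k κ : ℕ}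
    (hfix : FixesKrylov P (g * q) k M U) (hgq : IsUnit (aeval M (g * q)))
    (hdeg : g.natDegree + κ ≤ k) : FixesKrylov P q κ M U := by
  intro s hs
  rw [← ratAeval_mul_mul hgq]
  refine hfix _ ?_
  rcases eq_or_ne s 0 with rfl | hs0
  · simp
  · rw [← natDegree_lt_iff_degree_lt hs0] at hs
    refine degree_le_natDegree.trans_lt ?_
    have hmul : (g * s).natDegree ≤ g.natDegree + s.natDegree := natDegree_mul_le
    exact_mod_cast (by omega : (g * s).natDegree < k)

theorem FixesKrylov.submatrix {P M : Matrix n n R} {U : Matrix n u R} {q : R[X]} {κ : ℕ}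
    (hfix : FixesKrylov P q κ M U) {v : Type*} (e : v → u) :
    FixesKrylov P q κ M (U.submatrix id e) := fun s hs =>
  congrArg (fun Y : Matrix n u R => Y.submatrix id e) (hfix s hs)

/-- By `ratAeval_sub_ratAeval`, the generators of the new Krylov space differ from those of the old
one by elements of the old space. -/
theorem FixesKrylov.update [Fintype u] {P D : Matrix n n R} {U : Matrix n u R} {V : Matrix u n R}
    {q : R[X]} {κ : ℕ} (hfix : FixesKrylov P q κ D U) (hq : q.natDegree ≤ κ)
    (hD : IsUnit (aeval D q)) (hA : IsUnit (aeval (D + U * V) q)) :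
    FixesKrylov P q κ (D + U * V) U := by
  intro s hs
  have hbez : P * (aeval D q)⁻¹ * bezoutian s q D (D + U * V) =
      (aeval D q)⁻¹ * bezoutian s q D (D + U * V) := by
    refine map_bezoutian_eq (φ := LinearMap.mulLeft R (P * (aeval D q)⁻¹))
      (ψ := LinearMap.mulLeft R (aeval D q)⁻¹) (fun i hi j _ => ?_)
      (natDegree_le_of_degree_le hs.le) hq
    have hpow := hfix (X ^ i) (degree_X_pow_lt hi)
    rw [ratAeval_X_pow] at hpow
    simpa [Matrix.mul_assoc] using congrArg (· * (V * (D + U * V) ^ j)) hpow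
  have hdiff : P * (ratAeval s q (D + U * V) - ratAeval s q D) =
      ratAeval s q (D + U * V) - ratAeval s q D := by
    rw [ratAeval_sub_ratAeval hD hA, ← mul_assoc, ← mul_assoc, hbez]
  have hdiffU := congrArg (· * U) hdiff
  simp only [mul_sub, Matrix.sub_mul] at hdiffU
  rw [Matrix.mul_assoc P, Matrix.mul_assoc P, hfix s hs] at hdiffU
  exact sub_left_injective hdiffU

variable [Fintype p] [DecidableEq p]

theorem aeval_compression_mul {M : Matrix n n R} {W : Matrix n p R} {V : Matrix p n R}
    {Y : Matrix n u R} {κ : ℕ} (hfix : ∀ i < κ, W * V * (M ^ i * Y) = M ^ i * Y) {s : R[X]}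
    (hs : s.natDegree ≤ κ) :
    aeval (V * M * W) s * (V * Y) = V * (aeval M s * Y) := by
  have hpow : ∀ i ≤ κ, (V * M * W) ^ i * (V * Y) = V * (M ^ i * Y) := by
    intro i
    induction i with
    | zero => simp
    | succ i ih =>
      intro hi
      calc (V * M * W) ^ (i + 1) * (V * Y)
          = V * M * W * (V * (M ^ i * Y)) := by
            rw [pow_succ', Matrix.mul_assoc (V * M * W), ih (by omega)]
        _ = V * (M * (W * V * (M ^ i * Y))) := by simp only [Matrix.mul_assoc]
        _ = V * (M ^ (i + 1) * Y) := by rw [hfix i (by omega), pow_succ', Matrix.mul_assoc M]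
  simp only [aeval_eq_sum_range' (Nat.lt_succ_of_le hs), Matrix.sum_mul, Matrix.mul_sum,
    Matrix.smul_mul, Matrix.mul_smul]
  refine Finset.sum_congr rfl fun i hi => ?_
  rw [hpow i (Finset.mem_range_succ_iff.mp hi)]

/-- The generator `q(M)⁻¹ U` is compressed exactly, and `q` of the compressed matrix maps its
compression to that of `U`. -/
theorem FixesKrylov.ratAeval_mul_eq {M : Matrix n n R} {W : Matrix n p R} {V : Matrix p n R}
    {U : Matrix n u R} {q : R[X]} {κ : ℕ} (hfix : FixesKrylov (W * V) q κ M U)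
    (hq : q.natDegree ≤ κ) (hM : IsUnit (aeval M q)) (hH : IsUnit (aeval (V * M * W) q))
    {s : R[X]} (hs : s.degree < κ) :
    W * (ratAeval s q (V * M * W) * (V * U)) = ratAeval s q M * U := by
  have hpow : ∀ i < κ, W * V * (M ^ i * (ratAeval 1 q M * U)) = M ^ i * (ratAeval 1 q M * U) := by
    intro i hi
    have hmul : M ^ i * (ratAeval 1 q M * U) = ratAeval (X ^ i) q M * U := by
      rw [← Matrix.mul_assoc, ← mul_one (X ^ i), ← aeval_mul_ratAeval, map_pow, aeval_X]
    rw [hmul]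
    exact hfix _ (degree_X_pow_lt hi)
  have hdenom : aeval (V * M * W) q * (V * (ratAeval 1 q M * U)) = V * U := by
    rw [aeval_compression_mul hpow hq, ← Matrix.mul_assoc (aeval M q), aeval_mul_ratAeval, mul_one,
      ratAeval_self hM, Matrix.one_mul]
  calc W * (ratAeval s q (V * M * W) * (V * U))
      = W * (aeval (V * M * W) s * (V * (ratAeval 1 q M * U))) := by
        rw [← hdenom, ← Matrix.mul_assoc (ratAeval _ _ _), ratAeval_mul_aeval hH]
    _ = W * V * (ratAeval s q M * U) := by
        rw [aeval_compression_mul hpow (natDegree_le_of_degree_le hs.le),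
          ← Matrix.mul_assoc (aeval M s), aeval_mul_ratAeval, mul_one, Matrix.mul_assoc]
    _ = ratAeval s q M * U := hfix s hs

/-- By `ratAeval_sub_ratAeval` both sides are images of Bezoutians, so it is enough to compare the
images of the products `x ^ i * (x - y) * y ^ j`. -/
theorem FixesKrylov.ratAeval_update [Fintype u] {D A : Matrix n n R} {W : Matrix n p R}
    {U : Matrix n u R} {B : Matrix u u R} {s q : R[X]} {κ : ℕ}
    (hfix : FixesKrylov (W * Wᵀ) q κ D U) (hAD : A = D + U * B * Uᵀ) (hsymm : A.IsSymm)
    (hs : s.natDegree ≤ κ) (hq : q.natDegree ≤ κ)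
    (hD : IsUnit (aeval D q)) (hA : IsUnit (aeval A q))
    (hH : IsUnit (aeval (Wᵀ * D * W) q)) (hG : IsUnit (aeval (Wᵀ * A * W) q)) :
    ratAeval s q A - ratAeval s q D =
      W * (ratAeval s q (Wᵀ * A * W) - ratAeval s q (Wᵀ * D * W)) * Wᵀ := by
  have hfixA : FixesKrylov (W * Wᵀ) q κ A U := by
    rw [hAD, Matrix.mul_assoc] at hA ⊢
    exact hfix.update hq hD hA
  set H := Wᵀ * D * W
  set G := Wᵀ * A * W with hGdef
  have hGsymm : Gᵀ = G := by simp [hGdef, hsymm.eq, Matrix.mul_assoc]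
  have hDA : D - A = -(U * B * Uᵀ) := by simp [hAD]
  have hHG : H - G = -(Wᵀ * U * B * (Wᵀ * U)ᵀ) := by
    rw [← Matrix.sub_mul, ← Matrix.mul_sub, hDA]
    simp [Matrix.mul_assoc]
  let φ : Matrix n n R →ₗ[R] Matrix n n R :=
    LinearMap.mulRight R (aeval A q)⁻¹ ∘ₗ LinearMap.mulLeft R (aeval D q)⁻¹
  let ψ : Matrix p p R →ₗ[R] Matrix n n R :=
    mulRightLinearMap n R Wᵀ ∘ₗ mulLeftLinearMap p R W ∘ₗ
      LinearMap.mulRight R (aeval G q)⁻¹ ∘ₗ LinearMap.mulLeft R (aeval H q)⁻¹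
  have hφψ : ∀ i < κ, ∀ j < κ, φ (D ^ i * (D - A) * A ^ j) = ψ (H ^ i * (H - G) * G ^ j) := by
    intro i hi j hj
    calc φ (D ^ i * (D - A) * A ^ j)
        = -(ratAeval (X ^ i) q D * U * B * (ratAeval (X ^ j) q A * U)ᵀ) := by
          simp only [transpose_mul, transpose_ratAeval, hsymm.eq]
          rw [ratAeval_X_pow, ratAeval, (commute_nonsing_inv_aeval A _ _).eq]
          simp [φ, hDA, Matrix.mul_assoc]
      _ = -(W * (ratAeval (X ^ i) q H * (Wᵀ * U)) * B *
            (W * (ratAeval (X ^ j) q G * (Wᵀ * U)))ᵀ) := by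
          rw [hfix.ratAeval_mul_eq hq hD hH (degree_X_pow_lt hi),
            hfixA.ratAeval_mul_eq hq hA hG (degree_X_pow_lt hj)]
      _ = ψ (H ^ i * (H - G) * G ^ j) := by
          simp only [transpose_mul, transpose_ratAeval, hGsymm]
          rw [ratAeval_X_pow, ratAeval, (commute_nonsing_inv_aeval G _ _).eq]
          simp [ψ, hHG, Matrix.mul_assoc]
  rw [ratAeval_sub_ratAeval hD hA, ratAeval_sub_ratAeval hH hG]
  exact (map_bezoutian_eq hφψ hs hq).trans (by simp [ψ, Matrix.mul_assoc])

end RationalKrylov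

section BlockDiagonal

variable {R A o : Type*} [DecidableEq o] {m p u : o → Type*}

theorem isSymm_blockDiagonal' [Zero A] {D : ∀ i, Matrix (m i) (m i) A}
    (hD : ∀ i, (D i).IsSymm) : (Matrix.blockDiagonal' D).IsSymm := by
  rw [Matrix.IsSymm, blockDiagonal'_transpose]
  exact congrArg _ (funext hD)

variable [Fintype o] [∀ i, Fintype (m i)]

theorem blockDiag'_blockDiagonal'_mul_mul_transpose [CommSemiring R] (E : ∀ i, Matrix (p i) (m i) R)
    (M : Matrix (Σ i, m i) (Σ i, m i) R) :
    (Matrix.blockDiagonal' E * M * (Matrix.blockDiagonal' E)ᵀ).blockDiag' =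
      fun i => E i * M.blockDiag' i * (E i)ᵀ := by
  ext i x y
  simp [Matrix.mul_apply, Fintype.sum_sigma, blockDiag'_apply, blockDiagonal'_apply,
    Finset.sum_dite_irrel]

variable [∀ i, DecidableEq (m i)]

section Algebra

variable [CommSemiring R] [Semiring A] [Algebra R A]

variable (R A m) in
/-- `Matrix.blockDiagonal'` for square blocks, as a homomorphism of algebras. -/
def blockDiagonalAlgHom : (∀ i, Matrix (m i) (m i) A) →ₐ[R] Matrix (Σ i, m i) (Σ i, m i) A where
  toRingHom := blockDiagonal'RingHom m A
  commutes' c := by simp [Algebra.algebraMap_eq_smul_one, blockDiagonal'_smul]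

theorem aeval_blockDiagonal' (D : ∀ i, Matrix (m i) (m i) A) (s : R[X]) :
    aeval (blockDiagonal' D) s = blockDiagonal' fun i => aeval (D i) s := by
  have haeval : aeval D s = fun i => aeval (D i) s :=
    funext fun i => (aeval_algHom_apply (Pi.evalAlgHom R _ i) D s).symm
  rw [← haeval]
  exact aeval_algHom_apply (blockDiagonalAlgHom R A m) D s

end Algebra

variable [CommRing R]

theorem ratAeval_blockDiagonal' (s : R[X]) {q : R[X]} {D : ∀ i, Matrix (m i) (m i) R}
    (hD : ∀ i, IsUnit (aeval (D i) q)) :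
    ratAeval s q (blockDiagonal' D) = blockDiagonal' fun i => ratAeval s q (D i) := by
  have hinv : (blockDiagonal' fun i => aeval (D i) q)⁻¹ =
      blockDiagonal' fun i => (aeval (D i) q)⁻¹ := by
    refine Matrix.inv_eq_left_inv ?_
    rw [← blockDiagonal'_mul, ← blockDiagonal'_one]
    exact congrArg _ (funext fun i => ratAeval_self (hD i))
  rw [ratAeval, aeval_blockDiagonal', aeval_blockDiagonal', hinv, ← blockDiagonal'_mul]
  rfl

theorem fixesKrylov_blockDiagonal' {P D : ∀ i, Matrix (m i) (m i) R} {U : ∀ i, Matrix (m i) (u i) R}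
    {q : R[X]} {κ : ℕ} (hfix : ∀ i, FixesKrylov (P i) q κ (D i) (U i))
    (hD : ∀ i, IsUnit (aeval (D i) q)) :
    FixesKrylov (blockDiagonal' P) q κ (blockDiagonal' D) (blockDiagonal' U) := by
  intro s hs
  rw [ratAeval_blockDiagonal' s hD, ← blockDiagonal'_mul, ← blockDiagonal'_mul]
  exact congrArg _ (funext fun i => hfix i s hs)

end BlockDiagonal

section FunctionalCalculus

variable {𝕜 n p : Type*} [RCLike 𝕜] [Fintype n] [DecidableEq n] [Fintype p] [DecidableEq p]

theorem exists_polynomial_eqOn {F : Type*} [Field F] {S : Set F} (hS : S.Finite) (f : F → F) :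
    ∃ s : F[X], Set.EqOn f s.eval S := by
  classical
  exact ⟨Lagrange.interpolate hS.toFinset id f, fun x hx =>
    (Lagrange.eval_interpolate_at_node f (Set.injOn_id _) (hS.mem_toFinset.mpr hx)).symm⟩

theorem cfc_eq_aeval {M : Matrix n n 𝕜} (hM : M.IsHermitian) {f : ℝ → ℝ} {s : ℝ[X]}
    (h : Set.EqOn f s.eval (spectrum ℝ M)) : cfc f M = aeval M s :=
  (cfc_congr h).trans (cfc_polynomial s M hM.isSelfAdjoint)

theorem cfc_submatrix_equiv {M : Matrix n n 𝕜} (hM : M.IsHermitian) (f : ℝ → ℝ) (e : p ≃ n) :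
    cfc f (M.submatrix e e) = (cfc f M).submatrix e e := by
  let φ := Matrix.reindexAlgEquiv ℝ 𝕜 e.symm
  have hspec : spectrum ℝ (M.submatrix e e) = spectrum ℝ M := AlgEquiv.spectrum_eq φ M
  obtain ⟨s, hs⟩ := exists_polynomial_eqOn (finite_real_spectrum (A := M)) f
  rw [cfc_eq_aeval hM hs, cfc_eq_aeval (hM.submatrix e) (hspec ▸ hs)]
  exact Polynomial.aeval_algHom_apply φ.toAlgHom M s

section BlockDiagonal

variable {o : Type*} [Fintype o] [DecidableEq o] {m : o → Type*} [∀ i, Fintype (m i)]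
  [∀ i, DecidableEq (m i)] {D : ∀ i, Matrix (m i) (m i) 𝕜}

theorem spectrum_blockDiagonal'_subset :
    spectrum ℝ (blockDiagonal' D) ⊆ ⋃ i, spectrum ℝ (D i) := by
  rw [← Pi.spectrum_eq]
  exact AlgHom.spectrum_apply_subset (blockDiagonalAlgHom ℝ 𝕜 m) D

theorem cfc_blockDiagonal' (hD : ∀ i, (D i).IsHermitian) (f : ℝ → ℝ) :
    cfc f (blockDiagonal' D) = blockDiagonal' fun i => cfc f (D i) := by
  obtain ⟨s, hs⟩ := exists_polynomial_eqOn
    (Set.finite_iUnion fun i => finite_real_spectrum (A := D i)) f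
  have hblock : (blockDiagonal' D).IsHermitian := by
    rw [IsHermitian, blockDiagonal'_conjTranspose]
    exact congrArg _ (funext hD)
  rw [cfc_eq_aeval hblock (hs.mono spectrum_blockDiagonal'_subset), aeval_blockDiagonal']
  refine congrArg _ (funext fun i => ?_)
  rw [cfc_eq_aeval (hD i) (hs.mono (Set.subset_iUnion (fun i => spectrum ℝ (D i)) i))]

end BlockDiagonal

open ComplexOrder in
open scoped MatrixOrder in
theorem spectrum_subset_Icc_iff {M : Matrix n n 𝕜} (hM : M.IsHermitian) {a b : ℝ} :
    spectrum ℝ M ⊆ Set.Icc a b ↔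
      (M - algebraMap ℝ _ a).PosSemidef ∧ (algebraMap ℝ _ b - M).PosSemidef := by
  rw [← Matrix.le_iff, ← Matrix.le_iff, algebraMap_le_iff_le_spectrum hM.isSelfAdjoint,
    le_algebraMap_iff_spectrum_le hM.isSelfAdjoint]
  exact forall₂_and

open ComplexOrder in
theorem spectrum_submatrix_subset {M : Matrix n n 𝕜} (hM : M.IsHermitian) {e : p → n}
    (he : Function.Injective e) {a b : ℝ} (h : spectrum ℝ M ⊆ Set.Icc a b) :
    spectrum ℝ (M.submatrix e e) ⊆ Set.Icc a b := by
  have halg : ∀ c : ℝ, (algebraMap ℝ (Matrix n n 𝕜) c).submatrix e e = algebraMap ℝ _ c := by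
    simp [Algebra.algebraMap_eq_smul_one, submatrix_smul, submatrix_one e he]
  rw [spectrum_subset_Icc_iff hM] at h
  rw [spectrum_subset_Icc_iff (hM.submatrix e), ← halg, ← halg]
  exact ⟨h.1.submatrix e, h.2.submatrix e⟩

theorem isHermitian_of_isSymm {n : Type*} {M : Matrix n n ℝ} (hM : M.IsSymm) : M.IsHermitian :=
  (conjTranspose_eq_transpose_of_trivial M).trans hM

theorem isSymm_compression {n p : Type*} [Fintype n] {M : Matrix n n ℝ} (hM : M.IsSymm)
    (W : Matrix n p ℝ) : (Wᵀ * M * W).IsSymm := by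
  simp [Matrix.IsSymm, hM.eq, Matrix.mul_assoc]

theorem spectrum_compression_subset {M : Matrix n n ℝ} (hM : M.IsSymm) {W : Matrix n p ℝ}
    (hW : OrthonormalCols W) {a b : ℝ} (h : spectrum ℝ M ⊆ Set.Icc a b) :
    spectrum ℝ (Wᵀ * M * W) ⊆ Set.Icc a b := by
  have halg : ∀ c : ℝ, Wᵀ * algebraMap ℝ (Matrix n n ℝ) c * W = algebraMap ℝ _ c := fun c => by
    have hW' : Wᵀ * W = 1 := hW
    simp [Algebra.algebraMap_eq_smul_one, hW']
  rw [spectrum_subset_Icc_iff (isHermitian_of_isSymm hM)] at h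
  rw [spectrum_subset_Icc_iff (isHermitian_of_isSymm (isSymm_compression hM W)), ← halg, ← halg,
    ← Matrix.sub_mul, ← Matrix.mul_sub, ← Matrix.sub_mul, ← Matrix.mul_sub,
    ← conjTranspose_eq_transpose_of_trivial]
  exact ⟨h.1.conjTranspose_mul_mul_same W, h.2.conjTranspose_mul_mul_same W⟩

theorem isUnit_aeval_of_eval_ne_zero {M : Matrix n n 𝕜} (hM : M.IsHermitian) {q : ℝ[X]}
    (h : ∀ x ∈ spectrum ℝ M, q.eval x ≠ 0) : IsUnit (aeval M q) := by
  rw [← cfc_eq_aeval hM (Set.eqOn_refl q.eval _)]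
  exact (isUnit_cfc_iff _ M (finite_real_spectrum.continuousOn _) hM.isSelfAdjoint).mpr h

theorem cfc_div_eq_ratAeval {M : Matrix n n ℝ} (hM : M.IsHermitian) {s q : ℝ[X]}
    (h : ∀ x ∈ spectrum ℝ M, q.eval x ≠ 0) :
    cfc (fun x => s.eval x / q.eval x) M = ratAeval s q M := by
  have hcont : ∀ g : ℝ → ℝ, ContinuousOn g (spectrum ℝ M) := finite_real_spectrum.continuousOn
  have hmul : aeval M q * cfc (fun x => s.eval x / q.eval x) M = aeval M s := by
    rw [← cfc_eq_aeval hM (Set.eqOn_refl q.eval _), ← cfc_mul _ _ M (hcont _) (hcont _)]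
    exact cfc_eq_aeval hM fun x hx => mul_div_cancel₀ _ (h x hx)
  have hunit : (aeval M q)⁻¹ * aeval M q = 1 := ratAeval_self (isUnit_aeval_of_eval_ne_zero hM h)
  rw [ratAeval, ← hmul, ← mul_assoc, hunit, one_mul]

open scoped Matrix.Norms.L2Operator

theorem norm_le_one_of_orthonormalCols {n : Type*} [Fintype n] {W : Matrix n p ℝ}
    (hW : OrthonormalCols W) : ‖W‖ ≤ 1 := by
  have hone : ‖(1 : Matrix p p ℝ)‖ ≤ 1 := by
    rw [← diagonal_one, l2_opNorm_diagonal, pi_norm_le_iff_of_nonneg zero_le_one]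
    exact fun _ => norm_one.le
  have hsq : ‖W‖ * ‖W‖ ≤ 1 := by
    rwa [← l2_opNorm_conjTranspose_mul_self, conjTranspose_eq_transpose_of_trivial, hW]
  nlinarith [norm_nonneg W]

theorem norm_mul_mul_transpose_le {W : Matrix n p ℝ} (hW : OrthonormalCols W) (M : Matrix p p ℝ) :
    ‖W * M * Wᵀ‖ ≤ ‖M‖ := by
  have hnorm := norm_le_one_of_orthonormalCols hW
  have hnormT : ‖Wᵀ‖ ≤ 1 := by
    rwa [← conjTranspose_eq_transpose_of_trivial, Matrix.l2_opNorm_conjTranspose]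
  calc ‖W * M * Wᵀ‖ ≤ ‖W‖ * ‖M‖ * ‖Wᵀ‖ :=
        (Matrix.l2_opNorm_mul _ _).trans
          (mul_le_mul_of_nonneg_right (Matrix.l2_opNorm_mul _ _) (norm_nonneg _))
    _ ≤ 1 * ‖M‖ * 1 := by gcongr
    _ = ‖M‖ := by ring

theorem norm_cfc_le_of_isHermitian {M : Matrix n n 𝕜} (hM : M.IsHermitian) {f : ℝ → ℝ} {ε : ℝ}
    (hε : 0 ≤ ε) (h : ∀ x ∈ spectrum ℝ M, |f x| ≤ ε) : ‖cfc f M‖ ≤ ε := by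
  rw [hM.cfc_eq, IsHermitian.cfc, Unitary.conjStarAlgAut_apply, ← Unitary.coe_star,
    CStarRing.norm_mul_coe_unitary, CStarRing.norm_coe_unitary_mul, l2_opNorm_diagonal,
    pi_norm_le_iff_of_nonneg hε]
  intro i
  simpa using h _ (hM.eigenvalues_mem_spectrum_real i)

theorem norm_cfc_sub_cfc_le {M : Matrix n n 𝕜} (hM : M.IsHermitian) {f g : ℝ → ℝ} {ε : ℝ}
    (hε : 0 ≤ ε) (h : ∀ x ∈ spectrum ℝ M, |f x - g x| ≤ ε) : ‖cfc f M - cfc g M‖ ≤ ε := by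
  have hcont : ∀ g : ℝ → ℝ, ContinuousOn g (spectrum ℝ M) := finite_real_spectrum.continuousOn
  rw [← cfc_sub f g M (hcont f) (hcont g)]
  exact norm_cfc_le_of_isHermitian hM hε h

end FunctionalCalculus

section UpdateError

variable {n p u : Type*} [Fintype n] [DecidableEq n] [Fintype p] [DecidableEq p] [Fintype u]

theorem FixesKrylov.cfc_div_update {D A : Matrix n n ℝ} {W : Matrix n p ℝ} {U : Matrix n u ℝ}
    {B : Matrix u u ℝ} {s q : ℝ[X]} {κ : ℕ} {a b : ℝ} (hfix : FixesKrylov (W * Wᵀ) q κ D U)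
    (hW : OrthonormalCols W) (hAD : A = D + U * B * Uᵀ) (hD : D.IsSymm) (hA : A.IsSymm)
    (hDspec : spectrum ℝ D ⊆ Set.Icc a b) (hAspec : spectrum ℝ A ⊆ Set.Icc a b)
    (hs : s.natDegree ≤ κ) (hq : q.natDegree ≤ κ) (hq0 : ∀ x ∈ Set.Icc a b, q.eval x ≠ 0) :
    cfc (fun x => s.eval x / q.eval x) A - cfc (fun x => s.eval x / q.eval x) D =
      W * (cfc (fun x => s.eval x / q.eval x) (Wᵀ * A * W) -
        cfc (fun x => s.eval x / q.eval x) (Wᵀ * D * W)) * Wᵀ := by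
  have hDherm := isHermitian_of_isSymm hD
  have hAherm := isHermitian_of_isSymm hA
  have hHherm := isHermitian_of_isSymm (isSymm_compression hD W)
  have hGherm := isHermitian_of_isSymm (isSymm_compression hA W)
  have hD0 := fun x hx => hq0 x (hDspec hx)
  have hA0 := fun x hx => hq0 x (hAspec hx)
  have hH0 := fun x hx => hq0 x (spectrum_compression_subset hD hW hDspec hx)
  have hG0 := fun x hx => hq0 x (spectrum_compression_subset hA hW hAspec hx)
  rw [cfc_div_eq_ratAeval hDherm hD0, cfc_div_eq_ratAeval hAherm hA0,
    cfc_div_eq_ratAeval hHherm hH0, cfc_div_eq_ratAeval hGherm hG0]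
  exact hfix.ratAeval_update hAD hA hs hq
    (isUnit_aeval_of_eval_ne_zero hDherm hD0) (isUnit_aeval_of_eval_ne_zero hAherm hA0)
    (isUnit_aeval_of_eval_ne_zero hHherm hH0) (isUnit_aeval_of_eval_ne_zero hGherm hG0)

open scoped Matrix.Norms.L2Operator

theorem FixesKrylov.norm_cfc_update_sub_le {D A : Matrix n n ℝ} {W : Matrix n p ℝ}
    {U : Matrix n u ℝ} {B : Matrix u u ℝ} {s q : ℝ[X]} {κ : ℕ} {a b ε : ℝ} {f : ℝ → ℝ}
    (hfix : FixesKrylov (W * Wᵀ) q κ D U)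
    (hW : OrthonormalCols W) (hAD : A = D + U * B * Uᵀ) (hD : D.IsSymm) (hA : A.IsSymm)
    (hDspec : spectrum ℝ D ⊆ Set.Icc a b) (hAspec : spectrum ℝ A ⊆ Set.Icc a b)
    (hs : s.natDegree ≤ κ) (hq : q.natDegree ≤ κ) (hq0 : ∀ x ∈ Set.Icc a b, q.eval x ≠ 0)
    (hε : 0 ≤ ε) (hf : ∀ x ∈ Set.Icc a b, |f x - s.eval x / q.eval x| ≤ ε) :
    ‖cfc f A - (cfc f D - W * cfc f (Wᵀ * D * W) * Wᵀ + W * cfc f (Wᵀ * A * W) * Wᵀ)‖ ≤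
      4 * ε := by
  have hexact := hfix.cfc_div_update hW hAD hD hA hDspec hAspec hs hq hq0
  set r : ℝ → ℝ := fun x => s.eval x / q.eval x
  have herrA : ‖cfc f A - cfc r A‖ ≤ ε :=
    norm_cfc_sub_cfc_le (isHermitian_of_isSymm hA) hε fun x hx => hf x (hAspec hx)
  have herrD : ‖cfc f D - cfc r D‖ ≤ ε :=
    norm_cfc_sub_cfc_le (isHermitian_of_isSymm hD) hε fun x hx => hf x (hDspec hx)
  have herrG : ‖W * (cfc f (Wᵀ * A * W) - cfc r (Wᵀ * A * W)) * Wᵀ‖ ≤ ε :=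
    (norm_mul_mul_transpose_le hW _).trans <|
      norm_cfc_sub_cfc_le (isHermitian_of_isSymm (isSymm_compression hA W)) hε fun x hx =>
        hf x (spectrum_compression_subset hA hW hAspec hx)
  have herrH : ‖W * (cfc f (Wᵀ * D * W) - cfc r (Wᵀ * D * W)) * Wᵀ‖ ≤ ε :=
    (norm_mul_mul_transpose_le hW _).trans <|
      norm_cfc_sub_cfc_le (isHermitian_of_isSymm (isSymm_compression hD W)) hε fun x hx =>
        hf x (spectrum_compression_subset hD hW hDspec hx)
  calc ‖cfc f A - (cfc f D - W * cfc f (Wᵀ * D * W) * Wᵀ + W * cfc f (Wᵀ * A * W) * Wᵀ)‖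
      = ‖(cfc f A - cfc r A) - (cfc f D - cfc r D) +
          W * (cfc f (Wᵀ * D * W) - cfc r (Wᵀ * D * W)) * Wᵀ -
          W * (cfc f (Wᵀ * A * W) - cfc r (Wᵀ * A * W)) * Wᵀ‖ := by
        congr 1
        rw [← sub_eq_zero] at hexact ⊢
        rw [← hexact]
        simp only [Matrix.mul_sub, Matrix.sub_mul]
        abel
    _ ≤ ε + ε + ε + ε := (norm_sub_le _ _).trans (add_le_add ((norm_add_le _ _).trans
        (add_le_add ((norm_sub_le _ _).trans (add_le_add herrA herrD)) herrH)) herrG)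
    _ = 4 * ε := by ring

end UpdateError

section ClusterBlocks

variable {ℓ : ℕ} {s s' m p : Fin (2 ^ (ℓ + 1)) → ℕ}

theorem child_inj {τ τ' : Fin (2 ^ ℓ)} {b b' : Fin 2} :
    child τ b = child τ' b' ↔ τ = τ' ∧ b = b' :=
  finProdFinEquiv.injective.eq_iff.trans Prod.mk_inj

theorem split_castAdd (m : Fin (2 ^ (ℓ + 1)) → ℕ) (τ : Fin (2 ^ ℓ)) (i : Fin (m (child τ 0))) :
    split m ⟨τ, Fin.castAdd _ i⟩ = ⟨child τ 0, i⟩ :=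
  Fin.addCases_left i

theorem split_natAdd (m : Fin (2 ^ (ℓ + 1)) → ℕ) (τ : Fin (2 ^ ℓ)) (i : Fin (m (child τ 1))) :
    split m ⟨τ, Fin.natAdd _ i⟩ = ⟨child τ 1, i⟩ :=
  Fin.addCases_right i

theorem split_bijective (m : Fin (2 ^ (ℓ + 1)) → ℕ) : Function.Bijective (split m) := by
  refine (Fintype.bijective_iff_surjective_and_card _).mpr ⟨?_, ?_⟩
  · rintro ⟨σ, i⟩
    obtain ⟨⟨τ, b⟩, rfl⟩ := finProdFinEquiv.surjective σ
    fin_cases b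
    · exact ⟨⟨τ, Fin.castAdd _ i⟩, split_castAdd m τ i⟩
    · exact ⟨⟨τ, Fin.natAdd _ i⟩, split_natAdd m τ i⟩
  · simp only [Fintype.card_sigma, Fintype.card_fin]
    refine Eq.trans ?_ ((Fintype.sum_prod_type _).symm.trans (finProdFinEquiv.sum_comp m))
    exact Finset.sum_congr rfl fun τ _ => (Fin.sum_univ_two fun b => m (child τ b)).symm

/-- `split` as an equivalence. -/
def splitEquiv (m : Fin (2 ^ (ℓ + 1)) → ℕ) : BlockIdx (parentSize m) ≃ BlockIdx m :=
  Equiv.ofBijective (split m) (split_bijective m)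

theorem blkdiagU_eq_submatrix (U : ∀ τ, Matrix (Fin (s τ)) (Fin (m τ)) ℝ) :
    blkdiagU U = (blockDiagonal' U).submatrix id (splitEquiv m) :=
  rfl

/-- The family of the block diagonal matrices that consist of the blocks of two siblings. -/
def mergeDiag (Y : ∀ σ, Matrix (Fin (m σ)) (Fin (p σ)) ℝ) (τ : Fin (2 ^ ℓ)) :
    Matrix (Fin (parentSize m τ)) (Fin (parentSize p τ)) ℝ :=
  diag2 (Y (child τ 0)) (Y (child τ 1))

theorem blockDiagonal'_mergeDiag (Y : ∀ σ, Matrix (Fin (m σ)) (Fin (p σ)) ℝ) :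
    blockDiagonal' (mergeDiag Y) =
      (blockDiagonal' Y).submatrix (splitEquiv m) (splitEquiv p) := by
  have h01 {τ : Fin (2 ^ ℓ)} : child τ 0 ≠ child τ 1 := by simp [child_inj]
  ext ⟨τ, i⟩ ⟨τ', j⟩
  change _ = blockDiagonal' Y (split m ⟨τ, i⟩) (split p ⟨τ', j⟩)
  rcases eq_or_ne τ τ' with rfl | hτ
  · rw [blockDiagonal'_apply_eq]
    induction i using Fin.addCases <;> induction j using Fin.addCases <;>
      simp [split_castAdd, split_natAdd, blockDiagonal'_apply_ne _ _ _ h01,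
        blockDiagonal'_apply_ne _ _ _ h01.symm, mergeDiag, diag2, blockDiagonal'_apply_eq]
  · have hne : ∀ b c : Fin 2, child τ b ≠ child τ' c := fun b c h => hτ (child_inj.mp h).1
    rw [blockDiagonal'_apply_ne _ _ _ hτ]
    induction i using Fin.addCases <;> induction j using Fin.addCases <;>
      simp only [split_castAdd, split_natAdd, blockDiagonal'_apply_ne _ _ _ (hne _ _)]

theorem blkdiagU_transpose_mul_blkdiagU (W : ∀ τ, Matrix (Fin (s τ)) (Fin (p τ)) ℝ)
    (Z : ∀ τ, Matrix (Fin (s τ)) (Fin (m τ)) ℝ) :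
    (blkdiagU W)ᵀ * blkdiagU Z = blockDiagonal' (mergeDiag fun σ => (W σ)ᵀ * Z σ) := by
  rw [blockDiagonal'_mergeDiag, blockDiagonal'_mul, ← blockDiagonal'_transpose]
  rfl

theorem blkdiagU_transpose_mul_mul_blkdiagU (W : ∀ τ, Matrix (Fin (s τ)) (Fin (p τ)) ℝ)
    (D : ∀ τ, Matrix (Fin (s τ)) (Fin (s τ)) ℝ) :
    (blkdiagU W)ᵀ * blockDiagonal' D * blkdiagU W =
      blockDiagonal' (mergeDiag fun τ => (W τ)ᵀ * D τ * W τ) := by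
  rw [blockDiagonal'_mergeDiag, blockDiagonal'_mul, blockDiagonal'_mul, ← blockDiagonal'_transpose]
  rfl

theorem orthonormalCols_blkdiagU {W : ∀ τ, Matrix (Fin (s τ)) (Fin (p τ)) ℝ}
    (hW : ∀ τ, OrthonormalCols (W τ)) : OrthonormalCols (blkdiagU W) := by
  have hone : (fun σ => (W σ)ᵀ * W σ) = 1 := funext hW
  rw [OrthonormalCols, blkdiagU_transpose_mul_blkdiagU, hone, blockDiagonal'_mergeDiag,
    blockDiagonal'_one, submatrix_one_equiv]

theorem blkdiagU_mul_submatrix_mul_transpose (W : ∀ τ, Matrix (Fin (s τ)) (Fin (p τ)) ℝ)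
    (M : Matrix (BlockIdx p) (BlockIdx p) ℝ) :
    blkdiagU W * M.submatrix (splitEquiv p) (splitEquiv p) * (blkdiagU W)ᵀ =
      blockDiagonal' W * M * (blockDiagonal' W)ᵀ := by
  rw [blkdiagU_eq_submatrix, transpose_submatrix, submatrix_mul_equiv, submatrix_mul_equiv,
    submatrix_id_id]

theorem blkdiagU_mul_transpose (W : ∀ τ, Matrix (Fin (s τ)) (Fin (p τ)) ℝ) :
    blkdiagU W * (blkdiagU W)ᵀ = blockDiagonal' fun τ => W τ * (W τ)ᵀ := by
  rw [blkdiagU_eq_submatrix, transpose_submatrix, submatrix_mul_equiv, submatrix_id_id,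
    blockDiagonal'_transpose, blockDiagonal'_mul]

theorem blockDiagonal'_mul_blkdiagU (E : ∀ τ, Matrix (Fin (s' τ)) (Fin (s τ)) ℝ)
    (U : ∀ τ, Matrix (Fin (s τ)) (Fin (m τ)) ℝ) :
    blockDiagonal' E * blkdiagU U = blkdiagU fun τ => E τ * U τ := by
  rw [blkdiagU_eq_submatrix, blkdiagU_eq_submatrix, blockDiagonal'_mul]
  rfl

theorem blockDiagonal'_cfc_sub {D : ∀ τ, Matrix (Fin (s τ)) (Fin (s τ)) ℝ}
    (hD : ∀ τ, (D τ).IsSymm) (W : ∀ τ, Matrix (Fin (s τ)) (Fin (p τ)) ℝ) (f : ℝ → ℝ) :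
    (blockDiagonal' fun τ => cfc f (D τ) - W τ * cfc f ((W τ)ᵀ * D τ * W τ) * (W τ)ᵀ) =
      cfc f (blockDiagonal' D) -
        blkdiagU W * cfc f ((blkdiagU W)ᵀ * blockDiagonal' D * blkdiagU W) * (blkdiagU W)ᵀ := by
  have hH : ∀ τ, ((W τ)ᵀ * D τ * W τ).IsSymm := fun τ => isSymm_compression (hD τ) (W τ)
  rw [blkdiagU_transpose_mul_mul_blkdiagU, blockDiagonal'_mergeDiag,
    cfc_submatrix_equiv (isHermitian_of_isSymm (isSymm_blockDiagonal' hH)),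
    blkdiagU_mul_submatrix_mul_transpose, cfc_blockDiagonal' fun τ => isHermitian_of_isSymm (hD τ),
    cfc_blockDiagonal' fun τ => isHermitian_of_isSymm (hH τ), blockDiagonal'_transpose,
    ← blockDiagonal'_mul, ← blockDiagonal'_mul, ← blockDiagonal'_sub]
  rfl

end ClusterBlocks

section TelescopicDecompositions

theorem toMatrix_updateLeaves {L : ℕ} {s s' : Fin (2 ^ L) → ℕ} (t : TelDecomp L s)
    (E : ∀ τ, Matrix (Fin (s' τ)) (Fin (s τ)) ℝ) (F : ∀ τ, Matrix (Fin (s' τ)) (Fin (s' τ)) ℝ) :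
    (t.updateLeaves E F).toMatrix =
      blockDiagonal' F + blockDiagonal' E * t.toMatrix * (blockDiagonal' E)ᵀ := by
  have hleaves : ∀ D : ∀ τ, Matrix (Fin (s τ)) (Fin (s τ)) ℝ,
      (blockDiagonal' fun τ => F τ + E τ * D τ * (E τ)ᵀ) =
        blockDiagonal' F + blockDiagonal' E * blockDiagonal' D * (blockDiagonal' E)ᵀ := by
    intro D
    rw [blockDiagonal'_transpose, ← blockDiagonal'_mul, ← blockDiagonal'_mul, ← blockDiagonal'_add]
    rfl
  cases t with
  | root _ D => exact hleaves D
  | level _ m D U up =>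
    simp only [TelDecomp.updateLeaves, TelDecomp.toMatrix]
    rw [hleaves, ← blockDiagonal'_mul_blkdiagU]
    simp only [Matrix.mul_add, Matrix.add_mul, transpose_mul, Matrix.mul_assoc, add_assoc]

theorem isStandard_updateLeaves {L : ℕ} {s s' : Fin (2 ^ L) → ℕ} {t : TelDecomp L s}
    (ht : t.IsStandard) (E : ∀ τ, Matrix (Fin (s' τ)) (Fin (s τ)) ℝ)
    (F : ∀ τ, Matrix (Fin (s' τ)) (Fin (s' τ)) ℝ) : (t.updateLeaves E F).IsStandard := by
  cases t with
  | root => trivial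
  | level _ m D U up =>
    refine ⟨fun τ => ?_, ht.2⟩
    have hupdate := toMatrix_updateLeaves (TelDecomp.level _ m D U up) E F
    simp only [TelDecomp.updateLeaves] at hupdate
    rw [hupdate, blockDiag'_add, blockDiag'_blockDiagonal'_mul_mul_transpose,
      blockDiag'_blockDiagonal', Pi.add_apply, ht.1 τ]

variable {L : ℕ} {s m p : Fin (2 ^ (L + 1)) → ℕ}

theorem toMatrix_updateLeaves_mergeDiag (D : ∀ τ, Matrix (Fin (s τ)) (Fin (s τ)) ℝ)
    (Z : ∀ τ, Matrix (Fin (s τ)) (Fin (m τ)) ℝ) (up : TelDecomp L (parentSize m))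
    (W : ∀ τ, Matrix (Fin (s τ)) (Fin (p τ)) ℝ) :
    (up.updateLeaves (mergeDiag fun σ => (W σ)ᵀ * Z σ)
      (mergeDiag fun σ => (W σ)ᵀ * D σ * W σ)).toMatrix =
      (blkdiagU W)ᵀ * (TelDecomp.level s m D Z up).toMatrix * blkdiagU W := by
  rw [toMatrix_updateLeaves, ← blkdiagU_transpose_mul_blkdiagU,
    ← blkdiagU_transpose_mul_mul_blkdiagU, TelDecomp.toMatrix]
  simp only [Matrix.mul_add, Matrix.add_mul, transpose_mul, transpose_transpose, Matrix.mul_assoc]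

end TelescopicDecompositions

section RationalKrylovBases

theorem natDegree_poleDenom_le {k : ℕ} (ξ : Fin k → OnePoint ℂ) : (poleDenom ξ).natDegree ≤ k := by
  refine (natDegree_prod_le _ _).trans ?_
  calc ∑ j, ((ξ j).elim 1 fun z => X - C z : ℂ[X]).natDegree ≤ ∑ _j : Fin k, 1 := by
        refine Finset.sum_le_sum fun j _ => ?_
        induction ξ j using OnePoint.rec <;> simp
    _ = k := by simp

theorem poleDenom_ne_zero {k : ℕ} (ξ : Fin k → OnePoint ℂ) : poleDenom ξ ≠ 0 := by
  refine Finset.prod_ne_zero_iff.mpr fun j _ => ?_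
  induction ξ j using OnePoint.rec <;> simp [X_sub_C_ne_zero]

theorem exists_real_poleDenom {k : ℕ} {ξ : Fin k → OnePoint ℂ} (hξ : ConjClosed ξ) :
    ∃ Q : ℝ[X], Q.map (algebraMap ℝ ℂ) = poleDenom ξ := by
  obtain ⟨σ, hσ⟩ := hξ
  have hconj : (poleDenom ξ).map (starRingEnd ℂ) = poleDenom ξ := by
    rw [poleDenom, Polynomial.map_prod, ← Equiv.prod_comp σ (fun j => (ξ j).elim 1 _)]
    refine Finset.prod_congr rfl fun j _ => ?_
    rw [hσ j]
    induction ξ j using OnePoint.rec <;> simp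
  refine (mem_lifts _).mp ((lifts_iff_coeff_lifts _).mpr fun i => ?_)
  have hcoeff : starRingEnd ℂ ((poleDenom ξ).coeff i) = (poleDenom ξ).coeff i := by
    rw [← coeff_map, hconj]
  exact ⟨_, Complex.conj_eq_iff_re.mp hcoeff⟩

theorem isUnit_aeval_poleDenom {n k : ℕ} {M : Matrix (Fin n) (Fin n) ℝ} {ξ : Fin k → OnePoint ℂ}
    (hM : PolesAdmissible M ξ) : IsUnit (aeval (toC M) (poleDenom ξ)) := by
  refine Finset.prod_induction _ (fun s => IsUnit (aeval (toC M) s)) (fun s t hs ht => ?_) ?_ ?_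
  · rw [map_mul]
    exact hs.mul ht
  · simp
  · intro j _
    induction hj : ξ j using OnePoint.rec with
    | infty => simp
    | coe z =>
      have hz : z ∉ spectrum ℂ (toC M) := fun hz => hM z hz j hj
      rw [spectrum.notMem_iff] at hz
      rw [OnePoint.elim_some, map_sub, aeval_X, aeval_C, ← neg_sub]
      exact hz.neg

theorem toC_mul {l m n : Type*} [Fintype m] (M : Matrix l m ℝ) (N : Matrix m n ℝ) :
    toC (M * N) = toC M * toC N :=
  Matrix.map_mul (f := Complex.ofRealHom)

section Square

variable {n : Type*} [Fintype n] [DecidableEq n] {M : Matrix n n ℝ}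

theorem toC_aeval (M : Matrix n n ℝ) (Q : ℝ[X]) :
    toC (aeval M Q) = aeval (toC M) (Q.map (algebraMap ℝ ℂ)) := by
  rw [aeval_map_algebraMap]
  exact (aeval_algHom_apply (AlgHom.mapMatrix (m := n) (Algebra.ofId ℝ ℂ)) M Q).symm

theorem isUnit_of_isUnit_toC (h : IsUnit (toC M)) : IsUnit M := by
  rw [isUnit_iff_isUnit_det, isUnit_iff_ne_zero] at h ⊢
  have hdet : (toC M).det = (M.det : ℂ) := (Complex.ofRealHom.map_det M).symm
  exact fun h0 => h (by rw [hdet, h0, Complex.ofReal_zero])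

theorem toC_inv (h : IsUnit M) : (toC M)⁻¹ = toC M⁻¹ := by
  refine Matrix.inv_eq_right_inv ?_
  rw [← toC_mul, mul_nonsing_inv _ ((isUnit_iff_isUnit_det _).mp h)]
  exact Matrix.map_one _ Complex.ofReal_zero Complex.ofReal_one

end Square

variable {n c k p : ℕ} {M : Matrix (Fin n) (Fin n) ℝ} {B : Matrix (Fin n) (Fin c) ℝ}
  {ξ : Fin k → OnePoint ℂ} {Q : ℝ[X]}

theorem isUnit_aeval_of_polesAdmissible (hM : PolesAdmissible M ξ)
    (hQ : Q.map (algebraMap ℝ ℂ) = poleDenom ξ) : IsUnit (aeval M Q) := by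
  refine isUnit_of_isUnit_toC ?_
  rw [toC_aeval, hQ]
  exact isUnit_aeval_poleDenom hM

theorem ratAeval_mul_mem_ratKrylov (hM : PolesAdmissible M ξ)
    (hQ : Q.map (algebraMap ℝ ℂ) = poleDenom ξ) {s : ℝ[X]} (hs : s.degree < k) :
    ratAeval s Q M * B ∈ ratKrylov M B ξ := by
  refine ⟨fun j => s.coeff j • (1 : Matrix (Fin c) (Fin c) ℝ), ?_⟩
  have hsum : ∑ j : Fin k, M ^ (j : ℕ) * B * (s.coeff j • (1 : Matrix (Fin c) (Fin c) ℝ)) =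
      aeval M s * B := by
    rw [aeval_def, eval₂_eq_sum, ← sum_fin _ (by simp) hs, Matrix.sum_mul]
    simp only [← Algebra.smul_def, Matrix.mul_smul, Matrix.smul_mul, Matrix.mul_one]
  rw [hsum, ← hQ, ← toC_aeval, toC_inv (isUnit_aeval_of_polesAdmissible hM hQ), ← toC_mul,
    ← Matrix.mul_assoc]
  rfl

theorem IsOrthonormalBasisOf.mul_transpose_mul_eq {W : Matrix (Fin n) (Fin p) ℝ}
    {S : Set (Matrix (Fin n) (Fin c) ℝ)} (hW : IsOrthonormalBasisOf W S)
    {Y : Matrix (Fin n) (Fin c) ℝ} (hY : Y ∈ S) : W * Wᵀ * Y = Y := by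
  have hcol : ∀ j, (W * Wᵀ) *ᵥ Y.col j = Y.col j := by
    intro j
    have hmem : Y.col j ∈ Submodule.span ℝ (Set.range W.col) :=
      hW.2 ▸ Submodule.subset_span ⟨Y, hY, j, rfl⟩
    rw [← Matrix.range_mulVecLin] at hmem
    obtain ⟨v, hv⟩ := hmem
    rw [Matrix.mulVecLin_apply] at hv
    have hWW : Wᵀ * W = 1 := hW.1
    rw [← hv, Matrix.mulVec_mulVec, Matrix.mul_assoc, hWW, Matrix.mul_one]
  ext i j
  exact congrFun (hcol j) i

theorem IsOrthonormalBasisOf.fixesKrylov {W : Matrix (Fin n) (Fin p) ℝ}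
    (hW : IsOrthonormalBasisOf W (ratKrylov M B ξ)) (hM : PolesAdmissible M ξ) {κ : ℕ} {g q : ℝ[X]}
    (hgq : (g * q).map (algebraMap ℝ ℂ) = poleDenom ξ) (hdeg : g.natDegree + κ ≤ k) :
    FixesKrylov (W * Wᵀ) q κ M B := by
  have hfix : FixesKrylov (W * Wᵀ) (g * q) k M B := fun s hs =>
    hW.mul_transpose_mul_eq (ratAeval_mul_mem_ratKrylov hM hgq hs)
  exact hfix.of_mul (isUnit_aeval_of_polesAdmissible hM hgq) hdeg

theorem fixesKrylov_blkdiagU {ℓ κ : ℕ} {s m p : Fin (2 ^ (ℓ + 1)) → ℕ}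
    {D : ∀ τ, Matrix (Fin (s τ)) (Fin (s τ)) ℝ} {Z : ∀ τ, Matrix (Fin (s τ)) (Fin (m τ)) ℝ}
    {W : ∀ τ, Matrix (Fin (s τ)) (Fin (p τ)) ℝ} {q : ℝ[X]}
    (hfix : ∀ τ, FixesKrylov (W τ * (W τ)ᵀ) q κ (D τ) (Z τ))
    (hD : ∀ τ, IsUnit (aeval (D τ) q)) :
    FixesKrylov (blkdiagU W * (blkdiagU W)ᵀ) q κ (blockDiagonal' D) (blkdiagU Z) := by
  rw [blkdiagU_mul_transpose]
  exact (fixesKrylov_blockDiagonal' hfix hD).submatrix (splitEquiv m)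

end RationalKrylovBases

section ErrorBound

open scoped Matrix.Norms.L2Operator

theorem norm_submatrix_equiv_le {m n : Type*} [Fintype m] [DecidableEq m] [Fintype n]
    [DecidableEq n] (M : Matrix n n ℝ) (e : m ≃ n) : ‖M.submatrix e e‖ ≤ ‖M‖ := by
  set W : Matrix m n ℝ := (1 : Matrix n n ℝ).submatrix e id
  have hW : OrthonormalCols W := by
    rw [OrthonormalCols, transpose_submatrix, transpose_one, submatrix_mul_equiv, Matrix.mul_one,
      submatrix_id_id]
  have hWM : W * M * Wᵀ = M.submatrix e e := by
    rw [transpose_submatrix, transpose_one]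
    exact (congrArg (· * _) (one_submatrix_mul e (Equiv.refl n) M)).trans
      (mul_submatrix_one (Equiv.refl n) e (M.submatrix e id))
  exact hWM ▸ norm_mul_mul_transpose_le hW M

variable {k κ : ℕ} {ξ : Fin k → OnePoint ℂ} {f : ℝ → ℝ} {P g q : ℝ[X]} {a b ε : ℝ}

theorem norm_cfc_toMatrix_level_sub_le {L : ℕ} {s m p : Fin (2 ^ (L + 1)) → ℕ}
    {D : ∀ τ, Matrix (Fin (s τ)) (Fin (s τ)) ℝ} {Z : ∀ τ, Matrix (Fin (s τ)) (Fin (m τ)) ℝ}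
    {up : TelDecomp L (parentSize m)} {W : ∀ τ, Matrix (Fin (s τ)) (Fin (p τ)) ℝ}
    (hW : ∀ τ, OrthonormalCols (W τ))
    (hfix : ∀ τ, FixesKrylov (W τ * (W τ)ᵀ) q κ (D τ) (Z τ))
    (hstd : (TelDecomp.level s m D Z up).IsStandard)
    (hsymm : (TelDecomp.level s m D Z up).toMatrix.IsSymm)
    (hspec : spectrum ℝ (TelDecomp.level s m D Z up).toMatrix ⊆ Set.Icc a b)
    (hP : P.natDegree ≤ κ) (hq : q.natDegree ≤ κ) (hq0 : ∀ x ∈ Set.Icc a b, q.eval x ≠ 0)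
    (hε : 0 ≤ ε) (hf : ∀ x ∈ Set.Icc a b, |f x - P.eval x / q.eval x| ≤ ε)
    (out : TelDecomp L (parentSize p)) :
    ‖cfc f (TelDecomp.level s m D Z up).toMatrix - (TelDecomp.level s p
        (fun τ => cfc f (D τ) - W τ * cfc f ((W τ)ᵀ * D τ * W τ) * (W τ)ᵀ) W out).toMatrix‖ ≤
      4 * ε + ‖cfc f ((blkdiagU W)ᵀ * (TelDecomp.level s m D Z up).toMatrix * blkdiagU W) -
        out.toMatrix‖ := by
  have hblock : ∀ τ, (TelDecomp.level s m D Z up).toMatrix.submatrix (Sigma.mk τ) (Sigma.mk τ) =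
      D τ := hstd.1
  have hDsymm : ∀ τ, (D τ).IsSymm := fun τ => hblock τ ▸ hsymm.submatrix (Sigma.mk τ)
  have hDspec : ∀ τ, spectrum ℝ (D τ) ⊆ Set.Icc a b := fun τ =>
    hblock τ ▸ spectrum_submatrix_subset (isHermitian_of_isSymm hsymm) sigma_mk_injective hspec
  have hDunit : ∀ τ, IsUnit (aeval (D τ) q) := fun τ =>
    isUnit_aeval_of_eval_ne_zero (isHermitian_of_isSymm (hDsymm τ)) fun x hx => hq0 x (hDspec τ hx)
  have hWW := orthonormalCols_blkdiagU hW
  have hupdate := (fixesKrylov_blkdiagU hfix hDunit).norm_cfc_update_sub_le hWW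
    (A := (TelDecomp.level s m D Z up).toMatrix) rfl (isSymm_blockDiagonal' hDsymm) hsymm
    (spectrum_blockDiagonal'_subset.trans (Set.iUnion_subset hDspec)) hspec hP hq hq0 hε hf
  set A := (TelDecomp.level s m D Z up).toMatrix
  have hout : (TelDecomp.level s p
      (fun τ => cfc f (D τ) - W τ * cfc f ((W τ)ᵀ * D τ * W τ) * (W τ)ᵀ) W out).toMatrix =
      cfc f (blockDiagonal' D) - blkdiagU W *
        cfc f ((blkdiagU W)ᵀ * blockDiagonal' D * blkdiagU W) * (blkdiagU W)ᵀ +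
      blkdiagU W * cfc f ((blkdiagU W)ᵀ * A * blkdiagU W) * (blkdiagU W)ᵀ -
      blkdiagU W * (cfc f ((blkdiagU W)ᵀ * A * blkdiagU W) - out.toMatrix) * (blkdiagU W)ᵀ := by
    rw [TelDecomp.toMatrix, blockDiagonal'_cfc_sub hDsymm, Matrix.mul_sub, Matrix.sub_mul]
    abel
  rw [hout, sub_sub_eq_add_sub, add_sub_right_comm]
  exact (norm_add_le _ _).trans (add_le_add hupdate (norm_mul_mul_transpose_le hWW _))

variable (hgq : (g * q).map (algebraMap ℝ ℂ) = poleDenom ξ) (hdeg : g.natDegree + κ ≤ k)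
  (hP : P.natDegree ≤ κ) (hq : q.natDegree ≤ κ) (hq0 : ∀ x ∈ Set.Icc a b, q.eval x ≠ 0)
  (hε : 0 ≤ ε) (hf : ∀ x ∈ Set.Icc a b, |f x - P.eval x / q.eval x| ≤ ε)
include hgq hdeg hP hq hq0 hε hf

theorem AlgorithmRun.norm_cfc_toMatrix_sub_le {L : ℕ} {s : Fin (2 ^ L) → ℕ}
    {t out : TelDecomp L s} (run : AlgorithmRun f ξ t out) (hstd : t.IsStandard)
    (hsymm : t.toMatrix.IsSymm) (hspec : spectrum ℝ t.toMatrix ⊆ Set.Icc a b) :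
    ‖cfc f t.toMatrix - out.toMatrix‖ ≤ 4 * L * ε := by
  induction run with
  | root s D =>
    have hD : ∀ τ, (D τ).IsSymm := fun τ => by
      rw [← congrFun (blockDiag'_blockDiagonal' D) τ]
      exact hsymm.submatrix (Sigma.mk τ)
    rw [TelDecomp.toMatrix, TelDecomp.toMatrix,
      cfc_blockDiagonal' fun τ => isHermitian_of_isSymm (hD τ), sub_self, norm_zero]
    positivity
  | @level L s m p D Z up W out poles basis _ ih =>
    have hcompression := toMatrix_updateLeaves_mergeDiag D Z up W
    have hnext : ‖cfc f ((blkdiagU W)ᵀ * (TelDecomp.level s m D Z up).toMatrix * blkdiagU W) -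
        out.toMatrix‖ ≤ 4 * L * ε := by
      rw [← hcompression]
      refine ih (isStandard_updateLeaves hstd.2 _ _) ?_ ?_
      · exact hcompression ▸ isSymm_compression hsymm _
      · exact hcompression ▸
          spectrum_compression_subset hsymm (orthonormalCols_blkdiagU fun τ => (basis τ).1) hspec
    refine (norm_cfc_toMatrix_level_sub_le (fun τ => (basis τ).1)
      (fun τ => (basis τ).fixesKrylov (poles τ) hgq hdeg) hstd hsymm hspec hP hq hq0 hε hf
      out).trans ((add_le_add_right hnext _).trans_eq ?_)
    push_cast
    ring

theorem AlgorithmRun.norm2_cfc_sub_matrixOf_le {n L : ℕ} {T : ClusterTree n L}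
    {t out : TelDecomp L T.leafSize} (run : AlgorithmRun f ξ t out) (hstd : t.IsStandard)
    (hsymm : (T.matrixOf t).IsSymm) (hspec : spectrum ℝ (T.matrixOf t) ⊆ Set.Icc a b) :
    norm2 (cfc f (T.matrixOf t) - T.matrixOf out) ≤ 4 * L * ENNReal.ofReal ε := by
  have hback : (T.matrixOf t).submatrix T.enum T.enum = t.toMatrix :=
    (reindex T.enum T.enum).symm_apply_apply t.toMatrix
  have hsymm' : t.toMatrix.IsSymm := hback ▸ hsymm.submatrix T.enum
  have hspec' : spectrum ℝ t.toMatrix ⊆ Set.Icc a b :=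
    hback ▸ spectrum_submatrix_subset (isHermitian_of_isSymm hsymm) T.enum.injective hspec
  have hreindex : cfc f (T.matrixOf t) - T.matrixOf out =
      (cfc f t.toMatrix - out.toMatrix).submatrix T.enum.symm T.enum.symm :=
    congrArg (· - T.matrixOf out)
      (cfc_submatrix_equiv (isHermitian_of_isSymm hsymm') f T.enum.symm)
  have hbound : ‖cfc f (T.matrixOf t) - T.matrixOf out‖ ≤ 4 * L * ε :=
    hreindex ▸ (norm_submatrix_equiv_le _ T.enum.symm).trans
      (run.norm_cfc_toMatrix_sub_le hgq hdeg hP hq hq0 hε hf hstd hsymm' hspec')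
  have hofReal : 4 * L * ENNReal.ofReal ε = ENNReal.ofReal (4 * L * ε) := by
    rw [ENNReal.ofReal_mul (by positivity), ENNReal.ofReal_mul (by positivity)]
    simp
  rw [hofReal, norm2, ← ofReal_norm]
  exact ENNReal.ofReal_le_ofReal hbound

end ErrorBound

section RationalApproximation

theorem exists_mul_eq_of_roots_mem (I : Set ℝ) {Q : ℝ[X]} (hQ : Q ≠ 0) :
    ∃ g q : ℝ[X], g * q = Q ∧ (∀ x ∈ I, q.eval x ≠ 0) ∧
      ∀ z : ℂ, (g.map (algebraMap ℝ ℂ)).eval z = 0 → ∃ x ∈ I, z = x := by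
  induction hd : Q.natDegree using Nat.strong_induction_on generalizing Q with
  | _ d ih =>
    by_cases h : ∃ x ∈ I, Q.eval x = 0
    · obtain ⟨x, hx, hx0⟩ := h
      obtain ⟨R, rfl⟩ := dvd_iff_isRoot.mpr hx0
      have hR : R ≠ 0 := right_ne_zero_of_mul hQ
      have hlt : R.natDegree < d := by
        rw [← hd, natDegree_mul (X_sub_C_ne_zero x) hR, natDegree_X_sub_C]
        omega
      obtain ⟨g, q, hgq, hq, hg⟩ := ih _ hlt hR rfl
      refine ⟨(X - C x) * g, q, by rw [mul_assoc, hgq], hq, fun z hz => ?_⟩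
      rw [Polynomial.map_mul, eval_mul, mul_eq_zero] at hz
      rcases hz with hz | hz
      · exact ⟨x, hx, by simpa [sub_eq_zero] using hz⟩
      · exact hg z hz
    · push Not at h
      exact ⟨1, Q, one_mul Q, h, fun z hz => by simp at hz⟩

theorem ConjClosed.exists_real_factorization {k : ℕ} {ξ : Fin k → OnePoint ℂ} (hξ : ConjClosed ξ)
    (I : Set ℝ) :
    ∃ g q : ℝ[X], (g * q).map (algebraMap ℝ ℂ) = poleDenom ξ ∧ g.natDegree + q.natDegree ≤ k ∧
      (∀ x ∈ I, q.eval x ≠ 0) ∧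
      ∀ z : ℂ, (g.map (algebraMap ℝ ℂ)).eval z = 0 → ∃ x ∈ I, z = x := by
  obtain ⟨Q, hQ⟩ := exists_real_poleDenom hξ
  have hQ0 : Q ≠ 0 := by
    rintro rfl
    exact poleDenom_ne_zero ξ (by rw [← hQ, Polynomial.map_zero])
  obtain ⟨g, q, rfl, hq, hg⟩ := exists_mul_eq_of_roots_mem I hQ0
  refine ⟨g, q, hQ, ?_, hq, hg⟩
  rw [← natDegree_mul (left_ne_zero_of_mul hQ0) (right_ne_zero_of_mul hQ0),
    ← natDegree_map (algebraMap ℝ ℂ), hQ]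
  exact natDegree_poleDenom_le ξ

theorem evalAt_eq_div (r : RatFunc ℂ) (x : ℝ) :
    evalAt r x = r.num.eval (x : ℂ) / r.denom.eval (x : ℂ) := by
  rw [evalAt, RatFunc.eval, eval₂_id, eval₂_id]

theorem evalAt_div {p q : ℂ[X]} {x : ℝ} (hq : q.eval (x : ℂ) ≠ 0) :
    evalAt (algebraMap ℂ[X] (RatFunc ℂ) p / algebraMap ℂ[X] (RatFunc ℂ) q) x =
      p.eval (x : ℂ) / q.eval (x : ℂ) := by
  set r := algebraMap ℂ[X] (RatFunc ℂ) p / algebraMap ℂ[X] (RatFunc ℂ) q with hr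
  have hq0 : q ≠ 0 := fun h => hq (by rw [h, eval_zero])
  have hden : r.denom.eval (x : ℂ) ≠ 0 := fun h =>
    hq (eval_eq_zero_of_dvd_of_eval_eq_zero (RatFunc.denom_div_dvd p q) h)
  have hcross := congrArg (eval (x : ℂ)) ((RatFunc.num_mul_eq_mul_denom_iff hq0).mpr hr)
  rw [eval_mul, eval_mul] at hcross
  rw [evalAt_eq_div, div_eq_div_iff hden hq, hcross]

section Quotients

variable {k : ℕ} {ξ : Fin k → OnePoint ℂ} {g q : ℂ[X]}

theorem div_mem_ratSpace (hgq : g * q = poleDenom ξ) {κ : ℕ} (hdeg : g.natDegree + κ ≤ k)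
    {p : ℂ[X]} (hp : p.degree < κ) :
    algebraMap ℂ[X] (RatFunc ℂ) p / algebraMap ℂ[X] (RatFunc ℂ) q ∈ ratSpace ξ := by
  have hg0 : g ≠ 0 := left_ne_zero_of_mul (hgq ▸ poleDenom_ne_zero ξ)
  refine ⟨g * p, ?_, ?_⟩
  · rw [degree_mul, degree_eq_natDegree hg0]
    calc (g.natDegree : WithBot ℕ) + p.degree < g.natDegree + κ :=
          WithBot.add_lt_add_left WithBot.coe_ne_bot hp
      _ ≤ k := by exact_mod_cast hdeg
  · rw [← hgq, map_mul, map_mul, mul_div_mul_left _ _ (RatFunc.algebraMap_ne_zero hg0)]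

theorem exists_eq_div_of_denom_ne_zero (hgq : g * q = poleDenom ξ) {r : RatFunc ℂ}
    (hr : r ∈ ratSpace ξ) (hg : ∀ z : ℂ, g.eval z = 0 → r.denom.eval z ≠ 0) :
    ∃ p : ℂ[X], p.degree < ((k - g.natDegree : ℕ) : WithBot ℕ) ∧
      r = algebraMap ℂ[X] (RatFunc ℂ) p / algebraMap ℂ[X] (RatFunc ℂ) q := by
  obtain ⟨P, hP, hrP⟩ := hr
  have h0 : g * q ≠ 0 := hgq ▸ poleDenom_ne_zero ξ
  rw [← hgq] at hrP
  have hcoprime : IsCoprime r.denom g := by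
    rw [Polynomial.isCoprime_iff_aeval_ne_zero_of_isAlgClosed ℂ ℂ]
    intro z
    by_cases hz : g.eval z = 0
    · exact .inl (hg z hz)
    · exact .inr hz
  obtain ⟨c, hc⟩ : r.denom ∣ q :=
    hcoprime.dvd_of_dvd_mul_left (hrP ▸ RatFunc.denom_div_dvd P (g * q))
  have hrp : r = algebraMap ℂ[X] (RatFunc ℂ) (r.num * c) / algebraMap ℂ[X] (RatFunc ℂ) q := by
    rw [← RatFunc.num_mul_eq_mul_denom_iff (right_ne_zero_of_mul h0)]
    linear_combination r.num * hc
  refine ⟨r.num * c, ?_, hrp⟩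
  have hPeq : P = g * (r.num * c) := by
    refine mul_right_cancel₀ r.denom_ne_zero ?_
    rw [← (RatFunc.num_mul_eq_mul_denom_iff h0).mpr hrP]
    linear_combination r.num * g * hc
  by_cases hp0 : r.num * c = 0
  · rw [hp0, degree_zero]
    exact WithBot.bot_lt_coe _
  · rw [hPeq, degree_mul, degree_eq_natDegree (left_ne_zero_of_mul h0),
      degree_eq_natDegree hp0] at hP
    rw [degree_eq_natDegree hp0]
    have hlt : g.natDegree + (r.num * c).natDegree < k := by exact_mod_cast hP
    exact_mod_cast Nat.lt_sub_of_add_lt ((add_comm _ _).trans_lt hlt)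

end Quotients

section SupDist

variable {f : ℝ → ℝ} {a b : ℝ} {r : RatFunc ℂ}

theorem denom_eval_ne_zero_of_norm_evalAt_le {B : ℝ} (hab : a < b)
    (hB : ∀ x ∈ Set.Icc a b, ‖evalAt r x‖ ≤ B) {y : ℝ} (hy : y ∈ Set.Icc a b) :
    r.denom.eval (y : ℂ) ≠ 0 := by
  have hclosed : IsClosed {x : ℝ | ‖r.num.eval (x : ℂ)‖ ≤ B * ‖r.denom.eval (x : ℂ)‖} :=
    isClosed_le (r.num.continuous.comp Complex.continuous_ofReal).norm
      (continuous_const.mul (r.denom.continuous.comp Complex.continuous_ofReal).norm)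
  have hroots : {x : ℝ | r.denom.eval (x : ℂ) = 0}.Finite := by
    refine ((r.denom.rootSet_finite ℂ).preimage Complex.ofReal_injective.injOn).subset
      fun x hx => ?_
    exact mem_rootSet.mpr ⟨r.denom_ne_zero, hx⟩
  have hsub : Set.Ioo a b ∩ {x : ℝ | r.denom.eval (x : ℂ) = 0}ᶜ ⊆
      {x : ℝ | ‖r.num.eval (x : ℂ)‖ ≤ B * ‖r.denom.eval (x : ℂ)‖} := fun x ⟨hx, hx0⟩ => by
    have h := hB x (Set.Ioo_subset_Icc_self hx)
    rwa [evalAt_eq_div, norm_div, div_le_iff₀ (norm_pos_iff.mpr hx0)] at h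
  have hle : ‖r.num.eval (y : ℂ)‖ ≤ B * ‖r.denom.eval (y : ℂ)‖ := by
    rw [← closure_Ioo hab.ne] at hy
    exact closure_minimal ((hroots.countable.dense_compl ℝ).open_subset_closure_inter isOpen_Ioo)
      isClosed_closure hy |> closure_minimal hsub hclosed
  intro hr
  rw [hr, norm_zero, mul_zero, norm_le_zero_iff] at hle
  obtain ⟨u, v, huv⟩ := r.isCoprime_num_denom
  have h01 := congrArg (eval (y : ℂ)) huv
  simp [hle, hr] at h01

theorem norm_sub_evalAt_le_supDist (hr : supDist f r a b ≠ ⊤) {x : ℝ} (hx : x ∈ Set.Icc a b) :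
    ‖(f x : ℂ) - evalAt r x‖ ≤ (supDist f r a b).toReal := by
  rw [← toReal_enorm]
  exact ENNReal.toReal_mono hr
    (le_iSup₂ (f := fun x (_ : x ∈ Set.Icc a b) => ‖(f x : ℂ) - evalAt r x‖ₑ) x hx)

theorem supDist_eq_top (hab : a < b) (hf : Bornology.IsBounded (f '' Set.Icc a b)) {y : ℝ}
    (hy : y ∈ Set.Icc a b) (hr : r.denom.eval (y : ℂ) = 0) : supDist f r a b = ⊤ := by
  by_contra htop
  obtain ⟨M, hM⟩ := hf.exists_norm_le
  refine denom_eval_ne_zero_of_norm_evalAt_le (B := M + (supDist f r a b).toReal) hab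
    (fun x hx => ?_) hy hr
  have hfx : ‖(f x : ℂ)‖ ≤ M := (Complex.norm_real _).trans_le (hM _ ⟨x, hx, rfl⟩)
  calc ‖evalAt r x‖ = ‖(f x : ℂ) - ((f x : ℂ) - evalAt r x)‖ := by rw [sub_sub_cancel]
    _ ≤ ‖(f x : ℂ)‖ + ‖(f x : ℂ) - evalAt r x‖ := norm_sub_le _ _
    _ ≤ M + (supDist f r a b).toReal := add_le_add hfx (norm_sub_evalAt_le_supDist htop hx)

/-- At a pole `evalAt` returns `0`, so on an interval with at most one point a function with a pole
is no better than `0`; on all other intervals it is at distance `∞`. -/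
theorem supDist_zero_le (hf : Bornology.IsBounded (f '' Set.Icc a b)) {y : ℝ}
    (hy : y ∈ Set.Icc a b) (hr : r.denom.eval (y : ℂ) = 0) :
    supDist f 0 a b ≤ supDist f r a b := by
  rcases lt_or_ge a b with hab | hab
  · rw [supDist_eq_top hab hf hy hr]
    exact le_top
  · refine iSup₂_mono fun x hx => le_of_eq ?_
    obtain rfl : x = y := (Set.subsingleton_Icc_of_ge hab) hx hy
    rw [evalAt_eq_div r, hr, div_zero, evalAt, RatFunc.eval_zero]

end SupDist

section BestApproximation

variable {V : Type*} [AddCommGroup V] [Module ℂ V] [FiniteDimensional ℂ V]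

theorem exists_forall_norm_sub_le {E : Type*} [NormedAddCommGroup E] [NormedSpace ℂ E]
    (φ : V →ₗ[ℂ] E) (F : E) : ∃ v, ∀ w, ‖F - φ v‖ ≤ ‖F - φ w‖ := by
  have : ProperSpace (LinearMap.range φ) := FiniteDimensional.proper ℂ _
  have hcoercive : Filter.Tendsto (fun y : LinearMap.range φ => ‖F - y‖)
      (Filter.cocompact _) Filter.atTop := by
    refine Filter.tendsto_atTop_mono (f := fun y : LinearMap.range φ => -‖F‖ + ‖y‖) (fun y => ?_)
      (Filter.tendsto_atTop_add_const_left _ _ tendsto_norm_cocompact_atTop)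
    rw [neg_add_le_iff_le_add, Submodule.coe_norm, norm_sub_rev]
    exact norm_le_norm_add_norm_sub' _ _
  obtain ⟨⟨-, v, rfl⟩, hv⟩ := Continuous.exists_forall_le (by fun_prop) hcoercive
  exact ⟨v, fun w => hv ⟨φ w, w, rfl⟩⟩

theorem exists_forall_iSup_enorm_sub_le {X : Type*} (φ : V →ₗ[ℂ] X → ℂ)
    (hφ : ∀ v, ∃ B, ∀ x, ‖φ v x‖ ≤ B) {F : X → ℂ} {B : ℝ} (hF : ∀ x, ‖F x‖ ≤ B) :
    ∃ v, ∀ w, ⨆ x, ‖F x - φ v x‖ₑ ≤ ⨆ x, ‖F x - φ w x‖ₑ := by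
  let _ : TopologicalSpace X := ⊥
  have : DiscreteTopology X := ⟨rfl⟩
  choose C hC using hφ
  let ψ : V →ₗ[ℂ] BoundedContinuousFunction X ℂ :=
    { toFun := fun v => .ofNormedAddCommGroupDiscrete (φ v) (C v) (hC v)
      map_add' := fun v w => by ext; simp
      map_smul' := fun c v => by ext; simp }
  obtain ⟨v, hv⟩ := exists_forall_norm_sub_le ψ (.ofNormedAddCommGroupDiscrete F B hF)
  refine ⟨v, fun w => ?_⟩
  have hvw := enorm_le_iff_norm_le.mpr (hv w)
  rwa [BoundedContinuousFunction.enorm_eq_iSup_enorm,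
    BoundedContinuousFunction.enorm_eq_iSup_enorm] at hvw

end BestApproximation

/-- The linear map sending a polynomial `p` of degree less than `κ` to the function `p / q` on the
interval `[a, b]`. -/
def divMap (κ : ℕ) (q : ℂ[X]) (a b : ℝ) : degreeLT ℂ κ →ₗ[ℂ] Set.Icc a b → ℂ where
  toFun p x := (p : ℂ[X]).eval ((x : ℝ) : ℂ) / q.eval ((x : ℝ) : ℂ)
  map_add' p p' := by
    ext x
    simp [add_div]
  map_smul' c p := by
    ext x
    simp [mul_div_assoc]

section Minimizer

variable {f : ℝ → ℝ} {a b : ℝ} {κ : ℕ} {q : ℂ[X]}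

theorem exists_norm_divMap_le (hq : ∀ x ∈ Set.Icc a b, q.eval (x : ℂ) ≠ 0) (p : degreeLT ℂ κ) :
    ∃ B, ∀ x, ‖divMap κ q a b p x‖ ≤ B := by
  have hcont : ContinuousOn (fun x : ℝ => (p : ℂ[X]).eval (x : ℂ) / q.eval (x : ℂ))
      (Set.Icc a b) :=
    ((p : ℂ[X]).continuous.comp Complex.continuous_ofReal).continuousOn.div
      (q.continuous.comp Complex.continuous_ofReal).continuousOn hq
  obtain ⟨B, hB⟩ := isCompact_Icc.exists_bound_of_continuousOn hcont
  exact ⟨B, fun x => hB x x.2⟩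

theorem supDist_div_eq_iSup (f : ℝ → ℝ) (hq : ∀ x ∈ Set.Icc a b, q.eval (x : ℂ) ≠ 0)
    (p : degreeLT ℂ κ) :
    supDist f (algebraMap ℂ[X] (RatFunc ℂ) p / algebraMap ℂ[X] (RatFunc ℂ) q) a b =
      ⨆ x : Set.Icc a b, ‖(f x : ℂ) - divMap κ q a b p x‖ₑ := by
  rw [supDist, iSup_subtype']
  refine iSup_congr fun x => ?_
  rw [evalAt_div (hq x x.2)]
  rfl

theorem supDist_div_ne_top (hf : Bornology.IsBounded (f '' Set.Icc a b))
    (hq : ∀ x ∈ Set.Icc a b, q.eval (x : ℂ) ≠ 0) (p : degreeLT ℂ κ) :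
    supDist f (algebraMap ℂ[X] (RatFunc ℂ) p / algebraMap ℂ[X] (RatFunc ℂ) q) a b ≠ ⊤ := by
  obtain ⟨M, hM⟩ := hf.exists_norm_le
  obtain ⟨B, hB⟩ := exists_norm_divMap_le hq p
  rw [supDist_div_eq_iSup f hq]
  refine ((iSup_le fun x => ?_).trans_lt (ENNReal.ofReal_lt_top (r := M + B))).ne
  rw [← ofReal_norm]
  refine ENNReal.ofReal_le_ofReal ((norm_sub_le _ _).trans (add_le_add ?_ (hB x)))
  exact (Complex.norm_real _).trans_le (hM _ ⟨x, x.2, rfl⟩)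

theorem exists_isLeast_supDist {k : ℕ} {ξ : Fin k → OnePoint ℂ} {g : ℂ[X]}
    (hf : Bornology.IsBounded (f '' Set.Icc a b)) (hgq : g * q = poleDenom ξ)
    (hgk : g.natDegree ≤ k) (hq : ∀ x ∈ Set.Icc a b, q.eval (x : ℂ) ≠ 0)
    (hg : ∀ z : ℂ, g.eval z = 0 → ∃ x ∈ Set.Icc a b, z = x) :
    ∃ p : degreeLT ℂ (k - g.natDegree), IsLeast ((fun r => supDist f r a b) '' ratSpace ξ)
      (supDist f (algebraMap ℂ[X] (RatFunc ℂ) p / algebraMap ℂ[X] (RatFunc ℂ) q) a b) := by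
  obtain ⟨M, hM⟩ := hf.exists_norm_le
  obtain ⟨p, hp⟩ := exists_forall_iSup_enorm_sub_le (divMap (k - g.natDegree) q a b)
    (exists_norm_divMap_le hq) (F := fun x => (f x : ℂ)) (B := M)
    (fun x => (Complex.norm_real _).trans_le (hM _ ⟨x, x.2, rfl⟩))
  simp only [← supDist_div_eq_iSup f hq] at hp
  refine ⟨p, ⟨_, div_mem_ratSpace hgq (Nat.add_sub_of_le hgk).le (mem_degreeLT.mp p.2), rfl⟩, ?_⟩
  rintro _ ⟨r, hr, rfl⟩
  by_cases hpole : ∃ y ∈ Set.Icc a b, r.denom.eval (y : ℂ) = 0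
  · obtain ⟨y, hy, hy0⟩ := hpole
    have h0 := hp 0
    rw [ZeroMemClass.coe_zero, map_zero, zero_div] at h0
    exact h0.trans (supDist_zero_le hf hy hy0)
  · push Not at hpole
    obtain ⟨p', hp', rfl⟩ := exists_eq_div_of_denom_ne_zero hgq hr fun z hz => by
      obtain ⟨x, hx, rfl⟩ := hg z hz
      exact hpole x hx
    exact hp ⟨p', mem_degreeLT.mpr hp'⟩

end Minimizer

theorem exists_eval_eq_re_eval {κ : ℕ} {p : ℂ[X]} (hp : p.degree < κ) :
    ∃ P : ℝ[X], P.natDegree ≤ κ ∧ ∀ x : ℝ, P.eval x = (p.eval (x : ℂ)).re := by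
  refine ⟨∑ i ∈ Finset.range κ, C (p.coeff i).re * X ^ i, ?_, fun x => ?_⟩
  · refine natDegree_sum_le_of_forall_le _ _ fun i hi => ?_
    exact (natDegree_C_mul_X_pow_le _ _).trans (Finset.mem_range.mp hi).le
  · have hsum : p.eval (x : ℂ) = ∑ i ∈ Finset.range κ, p.coeff i * (x : ℂ) ^ i := by
      rw [eval_eq_sum, ← sum_fin _ (by simp) hp, Fin.sum_univ_eq_sum_range
        fun i => p.coeff i * (x : ℂ) ^ i]
    rw [hsum, Complex.re_sum, eval_finsetSum]
    refine Finset.sum_congr rfl fun i _ => ?_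
    rw [eval_mul, eval_C, eval_pow, eval_X, ← Complex.ofReal_pow, Complex.re_mul_ofReal]

theorem exists_real_isLeast_supDist {k : ℕ} {ξ : Fin k → OnePoint ℂ} {f : ℝ → ℝ} {a b : ℝ}
    {g q : ℝ[X]} (hf : Bornology.IsBounded (f '' Set.Icc a b))
    (hgq : (g * q).map (algebraMap ℝ ℂ) = poleDenom ξ) (hgk : g.natDegree ≤ k)
    (hq : ∀ x ∈ Set.Icc a b, q.eval x ≠ 0)
    (hg : ∀ z : ℂ, (g.map (algebraMap ℝ ℂ)).eval z = 0 → ∃ x ∈ Set.Icc a b, z = x) :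
    ∃ (P : ℝ[X]) (ε : ℝ), P.natDegree ≤ k - g.natDegree ∧ 0 ≤ ε ∧
      IsLeast ((fun r => supDist f r a b) '' ratSpace ξ) (ENNReal.ofReal ε) ∧
      ∀ x ∈ Set.Icc a b, |f x - P.eval x / q.eval x| ≤ ε := by
  have hqeval (x : ℝ) : (q.map (algebraMap ℝ ℂ)).eval (x : ℂ) = (q.eval x : ℝ) :=
    eval_map_apply (algebraMap ℝ ℂ) x
  have hqC : ∀ x ∈ Set.Icc a b, (q.map (algebraMap ℝ ℂ)).eval (x : ℂ) ≠ 0 := fun x hx => by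
    rw [hqeval]
    exact Complex.ofReal_ne_zero.mpr (hq x hx)
  rw [Polynomial.map_mul] at hgq
  obtain ⟨p, hp⟩ := exists_isLeast_supDist hf hgq (natDegree_map_le.trans hgk) hqC hg
  rw [← ENNReal.ofReal_toReal (supDist_div_ne_top hf hqC p)] at hp
  obtain ⟨P, hPdeg, hP⟩ := exists_eval_eq_re_eval (mem_degreeLT.mp p.2)
  rw [natDegree_map] at hPdeg
  refine ⟨P, _, hPdeg, ENNReal.toReal_nonneg, hp, fun x hx => ?_⟩
  have hre : f x - P.eval x / q.eval x =
      ((f x : ℂ) - (p : ℂ[X]).eval (x : ℂ) / (q.map (algebraMap ℝ ℂ)).eval (x : ℂ)).re := by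
    rw [Complex.sub_re, Complex.ofReal_re, hqeval, Complex.div_ofReal_re, hP]
  rw [hre, ← evalAt_div (hqC x hx)]
  exact (Complex.abs_re_le_norm _).trans
    (norm_sub_evalAt_le_supDist (supDist_div_ne_top hf hqC p) hx)

end RationalApproximation

theorem eq_of_norm2_sub_eq_zero {n : ℕ} {M N : Matrix (Fin n) (Fin n) ℝ} (h : norm2 (M - N) = 0) :
    M = N := by
  rwa [norm2, ← ofReal_norm, ENNReal.ofReal_eq_zero, norm_le_zero_iff,
    EmbeddingLike.map_eq_zero_iff, sub_eq_zero] at h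

theorem mainTheorem1_general {n L : ℕ} (T : ClusterTree n L) (t : TelDecomp L T.leafSize)
    (hstd : t.IsStandard) (hsymm : (T.matrixOf t).IsSymm) {k : ℕ} (ξ : Fin k → OnePoint ℂ)
    (hξ : ConjClosed ξ) (a b : ℝ) (hspec : spectrum ℝ (T.matrixOf t) ⊆ Set.Icc a b) (f : ℝ → ℝ)
    (hf : Bornology.IsBounded (f '' Set.Icc a b)) (out : TelDecomp L T.leafSize)
    (hout : AlgorithmRun f ξ t out) :
    (∃ μ : ENNReal, IsLeast ((fun r => supDist f r a b) '' ratSpace ξ) μ ∧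
      norm2 (cfc f (T.matrixOf t) - T.matrixOf out) ≤ 4 * (L : ENNReal) * μ) ∧
    ((∃ r ∈ ratSpace ξ, ∀ x ∈ Set.Icc a b, (f x : ℂ) = evalAt r x) →
      T.matrixOf out = cfc f (T.matrixOf t)) := by
  obtain ⟨g, q, hgq, hdeg, hq, hg⟩ := hξ.exists_real_factorization (Set.Icc a b)
  obtain ⟨P, ε, hP, hε, hleast, hPε⟩ :=
    exists_real_isLeast_supDist hf hgq (by omega) hq hg
  have hbound := hout.norm2_cfc_sub_matrixOf_le hgq (κ := k - g.natDegree) (by omega) hP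
    (by omega) hq hε hPε hstd hsymm hspec
  refine ⟨⟨_, hleast, hbound⟩, ?_⟩
  rintro ⟨r, hr, hfr⟩
  have hdist : supDist f r a b = 0 := by
    simp only [supDist, ENNReal.iSup_eq_zero]
    exact fun x hx => by rw [hfr x hx, sub_self, enorm_zero]
  have hzero : ENNReal.ofReal ε = 0 :=
    nonpos_iff_eq_zero.mp ((hleast.2 ⟨r, hr, rfl⟩).trans_eq hdist)
  rw [hzero, mul_zero] at hbound
  exact (eq_of_norm2_sub_eq_zero (nonpos_iff_eq_zero.mp hbound)).symm

end HSSFun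
end

open HSSFun in
theorem mainTheorem1 {n L : ℕ} (T : ClusterTree n L) (ρ : ℕ)
    (A : Matrix (Fin n) (Fin n) ℝ) (hsymm : A.IsSymm) (hHSS : T.IsHSS ρ A)
    (t : TelDecomp L T.leafSize) (ht : t.IsSymmetric) (hstd : t.IsStandard)
    (htA : T.matrixOf t = A)
    {k : ℕ} (ξ : Fin k → OnePoint ℂ) (hξ : ConjClosed ξ)
    (a b : ℝ) (hab : a ≤ b) (hspec : spectrum ℝ A ⊆ Set.Icc a b)
    (f : ℝ → ℝ) (hf : AnalyticOnNhd ℝ f (Set.Icc a b))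
    (out : TelDecomp L T.leafSize) (hout : AlgorithmRun f ξ t out) :
    (∃ μ : ENNReal, IsLeast ((fun r => supDist f r a b) '' ratSpace ξ) μ ∧
      norm2 (cfc f A - T.matrixOf out) ≤ 4 * (L : ENNReal) * μ) ∧
    ((∃ r ∈ ratSpace ξ, ∀ x ∈ Set.Icc a b, (f x : ℂ) = evalAt r x) → T.matrixOf out = cfc f A) := by
  subst htA
  exact mainTheorem1_general T t hstd hsymm ξ hξ a b hspec f
    (isCompact_Icc.image_of_continuousOn hf.continuousOn).isBounded out hout
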